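/- Finitely many squares are glued along sides: some sides are matched in pairs, and the two sides of each pair are identified by an affine homeomorphism that reverses the counterclockwise direction of the sides, as for neighboring squares in the plane. The boundary is the union of the unmatched sides. The result $\Delta$ is a \emph{quadriculated disk} if it is a closed topological disk in which every square is embedded and every vertex not on the boundary belongs to precisely four squares. Let $\Delta$ be a quadriculated disk whose squares are colored black and white so that squares with a common side have opposite colors, and suppose that the number $b$ of black squares equals the number $w$ of white squares. Label the black squares and the white squares by $1,\dots,b$, and let $B_\Delta$ be the $b\times b$ black-to-white matrix, with $(i,j)$ entry $1$ if the $i$-th black and the $j$-th white square share a side, and $0$ otherwise. Then $$\det(B_\Delta)\in\{0,1,-1\}.$$ Equivalently, the $(-1)$-weighted count of the domino tilings of $\Delta$ is $0$ or $\pm1$. Here a domino tiling $T$ is a bijection from the black squares to the white squares that pairs each black square with a white square sharing a side with it. If $\Delta$ has no domino tiling, the count is trivially $0$. Otherwise fix any tiling $T_0$; the count is $\sum_T \operatorname{sgn}(T_0^{-1}\circ T)$, where $T_0^{-1}\circ T$ is a permutation of the black squares (so exchanging the partners of two black squares changes the sign of the weight), and it equals $\det(B_\Delta)$ or $-\det(B_\Delta)$.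 -/

import Mathlib

/-- The model square `[0,1] × [0,1]`. -/
abbrev ModelSquare : Type := unitInterval × unitInterval

/-- The four sides of the model square, parametrized counterclockwise:
side `i` runs from the corner `i` to the corner `i + 1 (mod 4)`, where the corners
`0, 1, 2, 3` are `(0,0), (1,0), (1,1), (0,1)`. -/
def sidePoint : Fin 4 → unitInterval → ModelSquare
  | 0, t => (t, 0)
  | 1, t => (1, t)
  | 2, t => (unitInterval.symm t, 1)
  | 3, t => (0, unitInterval.symm t)

/-- Combinatorial data for juxtaposing a family of squares, indexed by `F`, along sides.
A side is a pair `(f, i)` of a square and an index `i`; the involution `glue` sends a side to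
the side to which it is attached, and its fixed points are the sides that are left free. -/
structure SquareGluing (F : Type*) where
  glue : F × Fin 4 → F × Fin 4
  glue_involutive : Function.Involutive glue

namespace SquareGluing

variable {F : Type*} (G : SquareGluing F)

/-- The elementary identifications on the disjoint union of the squares: a side is attached to
its mate by the affine map that reverses the counterclockwise parametrizations (so that the
orientations of the two squares agree). Free sides are not identified with anything. -/
def Attach (p q : (_ : F) × ModelSquare) : Prop :=
  ∃ (f : F) (i : Fin 4) (t : unitInterval), G.glue (f, i) ≠ (f, i) ∧
    p = ⟨f, sidePoint i t⟩ ∧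
    q = ⟨(G.glue (f, i)).1, sidePoint (G.glue (f, i)).2 (unitInterval.symm t)⟩

/-- The space formed by the squares: the quotient of the disjoint union of the squares by
the equivalence relation generated by the identifications of sides. -/
def Space : Type _ := Quot G.Attach

/-- The quotient topology. -/
instance : TopologicalSpace G.Space :=
  inferInstanceAs (TopologicalSpace (Quot G.Attach))

/-- The canonical map of the square `f` into the space. -/
def chart (f : F) (x : ModelSquare) : G.Space := Quot.mk _ ⟨f, x⟩

/-- The square `f` as a subset of the space. -/
def square (f : F) : Set G.Space := Set.range (G.chart f)

/-- The vertices: the images of the corners of the squares. -/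
def vertices : Set G.Space := {v | ∃ (f : F) (i : Fin 4), v = G.chart f (sidePoint i 0)}

/-- The boundary: the union of the free sides. -/
def boundary : Set G.Space :=
  {x | ∃ (f : F) (i : Fin 4) (t : unitInterval),
    G.glue (f, i) = (f, i) ∧ x = G.chart f (sidePoint i t)}

/-- A gluing of squares is a quadriculated disk if the resulting space is a closed topological
disk, in which every square is embedded, and every interior vertex belongs to precisely four
squares. -/
structure IsQuadriculatedDisk : Prop where
  homeomorph_disk :
    Nonempty (G.Space ≃ₜ Metric.closedBall (0 : EuclideanSpace ℝ (Fin 2)) 1)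
  square_embedded : ∀ f : F, Function.Injective (G.chart f)
  interior_vertex : ∀ v ∈ G.vertices, v ∉ G.boundary → {f : F | v ∈ G.square f}.ncard = 4

/-- The squares `f` and `g` share a side. -/
def ShareSide (f g : F) : Prop :=
  ∃ i j : Fin 4, G.glue (f, i) = (g, j) ∧ (f, i) ≠ (g, j)

/-- A bicoloring (`true` is black, `false` is white): squares with a common side have
opposite colors. -/
structure Bicoloring where
  color : F → Bool
  opposite : ∀ f g : F, G.ShareSide f g → color f ≠ color g

namespace Bicoloring

variable {G} (C : G.Bicoloring)

/-- The black squares. -/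
abbrev Black : Type _ := {f : F // C.color f = true}

/-- The white squares. -/
abbrev White : Type _ := {f : F // C.color f = false}

open Classical in
/-- The black-to-white matrix for a labeling of the black and of the white squares. -/
noncomputable def blackToWhite {b w : ℕ} (eb : C.Black ≃ Fin b) (ew : C.White ≃ Fin w) :
    Matrix (Fin b) (Fin w) ℤ :=
  Matrix.of fun i j =>
    if G.ShareSide ((eb.symm i : C.Black) : F) ((ew.symm j : C.White) : F) then 1 else 0

/-- A domino tiling: a pairing of all black squares with all white squares such that the two
squares of every pair (a domino) share a side. -/
def DominoTiling : Type _ :=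
  {T : C.Black ≃ C.White // ∀ x : C.Black, G.ShareSide (x : F) (T x : F)}

instance [Finite F] : Finite C.DominoTiling :=
  inferInstanceAs (Finite {T : C.Black ≃ C.White // ∀ x : C.Black, G.ShareSide (x : F) (T x : F)})

noncomputable instance [Finite F] : Fintype C.DominoTiling := Fintype.ofFinite _

open Classical in
/-- The weight `±1` of a tiling `T` relative to a reference tiling `T₀`: the sign of the
permutation of the black squares that sends `x` to the black square whose partner in `T₀` is the
partner of `x` in `T`. -/
noncomputable def tilingSign [Fintype F] (T₀ T : C.DominoTiling) : ℤˣ :=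
  Equiv.Perm.sign (T.1.trans T₀.1.symm)

/-- The weight is the one of the counting of tilings with `q = -1`: it is `1` at the reference
tiling and it changes sign under a flip, the exchange of the partners of two black squares. -/
theorem tilingSign_self [Fintype F] (T₀ : C.DominoTiling) : C.tilingSign T₀ T₀ = 1 := by
  simp [tilingSign]

theorem tilingSign_flip [Fintype F] (T₀ T T' : C.DominoTiling) (x y : C.Black) (hxy : x ≠ y)
    (hx : T'.1 x = T.1 y) (hy : T'.1 y = T.1 x)
    (h : ∀ z : C.Black, z ≠ x → z ≠ y → T'.1 z = T.1 z) :
    C.tilingSign T₀ T' = -C.tilingSign T₀ T := by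
  classical
  have key : T'.1.trans T₀.1.symm = (T.1.trans T₀.1.symm) * Equiv.swap x y := by
    ext1 z
    by_cases hzx : z = x
    · subst hzx; simp [hx]
    · by_cases hzy : z = y
      · subst hzy; simp [hy]
      · simp [h z hzx hzy, Equiv.swap_apply_of_ne_of_ne hzx hzy]
  unfold tilingSign
  convert congrArg Equiv.Perm.sign key using 1
  rw [Equiv.Perm.sign_mul, Equiv.Perm.sign_swap hxy]
  simp

/-- The `(-1)`-weighted count of the domino tilings, normalized by a reference tiling. -/
noncomputable def signedTilingCount [Fintype F] (T₀ : C.DominoTiling) : ℤ :=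
  ∑ T : C.DominoTiling, (C.tilingSign T₀ T : ℤ)

end Bicoloring

end SquareGluing

/-! The point is that a prime cannot divide the determinant unless the determinant is zero: a
nonzero kernel vector over `ZMod p` is converted into a nonzero integral one.

The disk develops into the square grid (`exists_position`). Signs given by the parity of the column
turn "the neighbors of every black square add up to zero" into the discrete wave equation `g₀ - g₁ +
g₂ - g₃ = 0`, with value zero beyond free sides. The equation says that, at opposite corners of a
black square, the increments of `g` between consecutive neighbors are opposite. These increments are
thus a flow along the two diagonals of each black square. The nodes are the interior vertices and
the boundary arcs between consecutive free black sides; around a node the increments telescope, so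
the flow is conserved.

Whether a finite graph carries a nonzero flow depends only on its having a cycle, not on the
coefficient group (`exists_int_flow_of_flow`). So there is a nonzero integral flow, and the topology
of the disk lets it be integrated back (`exists_harmonic_of_flow`). Simple connectedness yields a
potential once the increments close up around interior vertices
(`IsQuadriculatedDisk.exists_potential`, by covering spaces). The boundary is a single cycle
(`sameCycle_rot`), so the values beyond the free black sides are one common constant, which is
subtracted. If the original flow is zero, `g` is a nonzero constant and the constant `1` is an
integral solution. -/

open Topology

/-! ### Corners, sides, and the rotation about a vertex -/

/-- The open neighborhood of the corner `i` of the model square: the complement of the two sides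
that do not contain this corner. -/
def cornerStar : Fin 4 → Set ModelSquare
  | 0 => {x | x.1 < 1 ∧ x.2 < 1}
  | 1 => {x | 0 < x.1 ∧ x.2 < 1}
  | 2 => {x | 0 < x.1 ∧ 0 < x.2}
  | 3 => {x | x.1 < 1 ∧ 0 < x.2}

theorem isOpen_cornerStar (i : Fin 4) : IsOpen (cornerStar i) := by
  have h1 : ∀ {φ ψ : ModelSquare → unitInterval}, Continuous φ → Continuous ψ →
      IsOpen {x | φ x < ψ x} := fun h h' => isOpen_lt h h'
  fin_cases i
  · exact (h1 (by fun_prop) (by fun_prop)).inter (h1 (by fun_prop) (by fun_prop))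
  · exact (h1 (by fun_prop) (by fun_prop)).inter (h1 (by fun_prop) (by fun_prop))
  · exact (h1 (by fun_prop) (by fun_prop)).inter (h1 (by fun_prop) (by fun_prop))
  · exact (h1 (by fun_prop) (by fun_prop)).inter (h1 (by fun_prop) (by fun_prop))

theorem exists_mem_cornerStar (x : ModelSquare) : ∃ i, x ∈ cornerStar i := by
  rcases lt_or_ge x.1 1 with h | h <;> rcases lt_or_ge x.2 1 with h' | h'
  · exact ⟨0, h, h'⟩
  · exact ⟨3, h, lt_of_lt_of_le zero_lt_one h'⟩
  · exact ⟨1, lt_of_lt_of_le zero_lt_one h, h'⟩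
  · exact ⟨2, lt_of_lt_of_le zero_lt_one h, lt_of_lt_of_le zero_lt_one h'⟩

theorem unitInterval.symm_pos_iff {t : unitInterval} : 0 < unitInterval.symm t ↔ t < 1 := by
  rw [← unitInterval.symm_one, unitInterval.symm_lt_symm]

theorem unitInterval.symm_lt_one_iff {t : unitInterval} : unitInterval.symm t < 1 ↔ 0 < t := by
  rw [← unitInterval.symm_zero, unitInterval.symm_lt_symm]

/-- A point of the side `i` lies in the star of the corner `k` exactly if `k` is one of the ends
of the side and the point is not the other end. -/
theorem sidePoint_mem_cornerStar {i k : Fin 4} {t : unitInterval} :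
    sidePoint i t ∈ cornerStar k ↔ (k = i ∧ t < 1) ∨ (k = i + 1 ∧ 0 < t) := by
  fin_cases i <;> fin_cases k <;>
    simp [sidePoint, cornerStar, unitInterval.symm_pos_iff, unitInterval.symm_lt_one_iff]

theorem sidePoint_one (i : Fin 4) : sidePoint i 1 = sidePoint (i + 1) 0 := by
  fin_cases i <;> simp [sidePoint]

theorem sidePoint_eq_corner {i k : Fin 4} {t : unitInterval} :
    sidePoint i t = sidePoint k 0 ↔ (k = i ∧ t = 0) ∨ (k = i + 1 ∧ t = 1) := by
  fin_cases i <;> fin_cases k <;>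
    simp [sidePoint, Prod.ext_iff, unitInterval.symm_eq_zero, unitInterval.symm_eq_one]

theorem corner_injective : Function.Injective fun i : Fin 4 => sidePoint i 0 := by
  intro i k h
  rcases sidePoint_eq_corner.1 h with h | h
  · exact h.1.symm
  · exact absurd h.2 zero_ne_one

namespace SquareGluing

variable {F : Type*} (G : SquareGluing F)

theorem Attach.symm {G : SquareGluing F} {p q : (_ : F) × ModelSquare} (h : G.Attach p q) :
    G.Attach q p := by
  obtain ⟨f, i, t, hne, rfl, rfl⟩ := h
  refine ⟨(G.glue (f, i)).1, (G.glue (f, i)).2, unitInterval.symm t, ?_, rfl, ?_⟩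
  · simpa [G.glue_involutive (f, i)] using hne.symm
  · simp [G.glue_involutive (f, i)]

/-- A subset of the disjoint union of the squares that is invariant under the identifications
descends to the quotient. -/
theorem mk_mem_iff_of_attach {P : ((_ : F) × ModelSquare) → Prop}
    (hP : ∀ p q, G.Attach p q → P p → P q) {p q : (_ : F) × ModelSquare}
    (h : (Quot.mk G.Attach p) = Quot.mk G.Attach q) (hp : P p) : P q := by
  have : (Quot.lift P fun a b hab => propext ⟨hP a b hab, hP b a hab.symm⟩ : Quot G.Attach → Prop)
      (Quot.mk _ q) := by
    rw [← h]; exact hp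
  exact this

/-- The permutation of the corners `(f, i)` that turns clockwise about a vertex: the corner `i` of
`f` is sent to the corner of the neighbor across the side `i - 1`. If this side is free, the result
is the corner `i - 1` of `f`, the next vertex along the boundary. -/
def rot : Equiv.Perm (F × Fin 4) :=
  ((Equiv.refl F).prodCongr (Equiv.subRight 1)).trans G.glue_involutive.toPerm

theorem rot_apply (f : F) (i : Fin 4) : G.rot (f, i) = G.glue (f, i - 1) := rfl

theorem rot_succ (f : F) (i : Fin 4) : G.rot (f, i + 1) = G.glue (f, i) := by
  simp [rot_apply]

/-- The corner `(f, i)` is free if the side `i - 1` of `f`, which ends there, is free. -/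
def FreeCorner (κ : F × Fin 4) : Prop := G.glue (κ.1, κ.2 - 1) = (κ.1, κ.2 - 1)

/-- The corner as a point of the space. -/
def cornerPoint (κ : F × Fin 4) : G.Space := G.chart κ.1 (sidePoint κ.2 0)

theorem chart_glue {f : F} {i : Fin 4} (h : G.glue (f, i) ≠ (f, i)) (t : unitInterval) :
    G.chart f (sidePoint i t) =
      G.chart (G.glue (f, i)).1 (sidePoint (G.glue (f, i)).2 (unitInterval.symm t)) :=
  Quot.sound ⟨f, i, t, h, rfl, rfl⟩

theorem cornerPoint_rot {κ : F × Fin 4} (h : ¬ G.FreeCorner κ) :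
    G.cornerPoint (G.rot κ) = G.cornerPoint κ := by
  obtain ⟨f, i⟩ := κ
  have := G.chart_glue h 1
  rw [sidePoint_one] at this
  simpa [cornerPoint, rot_apply] using this.symm

theorem glue_eq_rot_succ (s : F × Fin 4) : G.glue s = G.rot (s.1, s.2 + 1) := by
  simp [rot_apply]

theorem rot_glue_succ (s : F × Fin 4) : G.rot ((G.glue s).1, (G.glue s).2 + 1) = s := by
  simp [rot_apply, G.glue_involutive s]

theorem cornerPoint_glue_succ {s : F × Fin 4} (h : G.glue s ≠ s) :
    G.cornerPoint ((G.glue s).1, (G.glue s).2 + 1) = G.cornerPoint s := by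
  have h2 : ¬ G.FreeCorner ((G.glue s).1, (G.glue s).2 + 1) := by
    simpa [FreeCorner, G.glue_involutive s] using h.symm
  simpa [rot_glue_succ] using (G.cornerPoint_rot h2).symm

theorem cornerPoint_glue {s : F × Fin 4} (h : G.glue s ≠ s) :
    G.cornerPoint (G.glue s) = G.cornerPoint (s.1, s.2 + 1) := by
  have h2 : ¬ G.FreeCorner (s.1, s.2 + 1) := by simpa [FreeCorner] using h
  rw [← G.cornerPoint_rot h2, ← glue_eq_rot_succ]

theorem continuous_chart (f : F) : Continuous (G.chart f) :=
  continuous_quot_mk.comp continuous_sigmaMk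

theorem IsQuadriculatedDisk.connectedSpace {G : SquareGluing F} (hG : G.IsQuadriculatedDisk) :
    ConnectedSpace G.Space := by
  obtain ⟨Φ⟩ := hG.homeomorph_disk
  have : ConnectedSpace (Metric.closedBall (0 : EuclideanSpace ℝ (Fin 2)) 1) :=
    isConnected_iff_connectedSpace.1
      ((convex_closedBall _ _).isConnected ⟨0, by simp⟩)
  exact Φ.symm.surjective.connectedSpace Φ.symm.continuous

/-- The squares of a quadriculated disk are connected through their common sides. -/
theorem IsQuadriculatedDisk.eq_of_glue {G : SquareGluing F} (hG : G.IsQuadriculatedDisk)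
    {X : Type*} (u : F → X) (hu : ∀ s, u (G.glue s).1 = u s.1) (f g : F) : u f = u g := by
  have := hG.connectedSpace
  -- For the discrete topology on `X`, `u` descends to a continuous function on a connected space.
  let _ : TopologicalSpace X := ⊥
  have : DiscreteTopology X := ⟨rfl⟩
  let φ : G.Space → X := Quot.lift (fun p => u p.1) (by
    rintro _ _ ⟨f, i, t, -, rfl, rfl⟩
    exact (hu (f, i)).symm)
  have hφ : Continuous φ := by
    refine continuous_quot_lift _ ?_
    exact continuous_sigma fun f => (continuous_const : Continuous fun _ : ModelSquare => u f)
  exact PreconnectedSpace.constant inferInstance hφ (x := G.chart f 0) (y := G.chart g 0)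

/-- Different corners of a square are different vertices. -/
theorem IsQuadriculatedDisk.corner_unique {G : SquareGluing F} (hG : G.IsQuadriculatedDisk)
    {f : F} {i j : Fin 4} (h : G.cornerPoint (f, i) = G.cornerPoint (f, j)) : i = j :=
  corner_injective (hG.square_embedded f h)

/-- Around a vertex with no free corner, exactly four corners meet. -/
theorem IsQuadriculatedDisk.minimalPeriod_rot [Finite F] {G : SquareGluing F}
    (hG : G.IsQuadriculatedDisk) {κ : F × Fin 4} (h : ∀ n, ¬ G.FreeCorner (G.rot^[n] κ)) :
    Function.minimalPeriod G.rot κ = 4 := by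
  have hper : κ ∈ Function.periodicPts G.rot := by
    have : Fintype F := Fintype.ofFinite F
    exact G.rot.injective.mem_periodicPts κ
  have hpos := Function.minimalPeriod_pos_of_mem_periodicPts hper
  have hpt : ∀ n, G.cornerPoint (G.rot^[n] κ) = G.cornerPoint κ := by
    intro n
    induction n with
    | zero => rfl
    | succ n ih => rw [Function.iterate_succ_apply', G.cornerPoint_rot (h n), ih]
  have hback : ∀ κ' n, G.rot κ' = G.rot^[n] κ → ∃ m, κ' = G.rot^[m] κ := by
    intro κ' n hn
    rcases n with _ | n
    · refine ⟨Function.minimalPeriod G.rot κ - 1, G.rot.injective ?_⟩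
      rw [← Function.iterate_succ_apply' G.rot, Nat.succ_eq_add_one, Nat.sub_add_cancel hpos,
        Function.iterate_minimalPeriod, hn]
      rfl
    · rw [Function.iterate_succ_apply'] at hn
      exact ⟨n, G.rot.injective hn⟩
  -- The `rot`-orbit of `κ` is closed under `Attach`, so it exhausts the preimage of the vertex.
  -- Hence the vertex is off the boundary, and its squares are those of the orbit.
  let P : ((_ : F) × ModelSquare) → Prop :=
    fun p => ∃ n, (G.rot^[n] κ).1 = p.1 ∧ p.2 = sidePoint (G.rot^[n] κ).2 0
  have hP : ∀ p q, G.Attach p q → P p → P q := by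
    rintro _ _ ⟨f, i, t, hne, rfl, rfl⟩ ⟨n, hf, hx⟩
    rcases sidePoint_eq_corner.1 hx with ⟨hk, rfl⟩ | ⟨hk, rfl⟩
    · have hs : G.rot^[n] κ = (f, i) := Prod.ext hf hk
      obtain ⟨m, hm⟩ := hback _ n ((G.rot_glue_succ (f, i)).trans hs.symm)
      refine ⟨m, by rw [← hm], ?_⟩
      rw [← hm]
      simp [sidePoint_one]
    · have hs : G.rot^[n] κ = (f, i + 1) := Prod.ext hf hk
      refine ⟨n + 1, ?_, ?_⟩ <;> simp [Function.iterate_succ_apply', hs, G.rot_succ]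
  have hmem : ∀ f x, G.chart f x = G.cornerPoint κ → ∃ n, G.rot^[n] κ = (f, (G.rot^[n] κ).2) ∧
      x = sidePoint (G.rot^[n] κ).2 0 := by
    intro f x hx
    obtain ⟨n, hn, hn'⟩ := G.mk_mem_iff_of_attach hP (p := ⟨κ.1, sidePoint κ.2 0⟩) (q := ⟨f, x⟩)
      hx.symm ⟨0, rfl, rfl⟩
    exact ⟨n, Prod.ext hn rfl, hn'⟩
  have hbd : G.cornerPoint κ ∉ G.boundary := by
    rintro ⟨f, i, t, hfree, hx⟩
    obtain ⟨n, hn, hn'⟩ := hmem _ _ hx.symm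
    rcases sidePoint_eq_corner.1 hn' with ⟨hk, -⟩ | ⟨hk, -⟩
    · rw [hk] at hn
      obtain ⟨m, hm⟩ := hback (f, i + 1) n (by rw [G.rot_succ, hfree, hn])
      apply h m
      rw [← hm]
      simpa [FreeCorner] using hfree
    · apply h n
      rw [hn, hk]
      simpa [FreeCorner] using hfree
  have hset : {f : F | G.cornerPoint κ ∈ G.square f} =
      (fun n => (G.rot^[n] κ).1) '' (Finset.range (Function.minimalPeriod G.rot κ) : Set ℕ) := by
    ext f
    constructor
    · rintro ⟨x, hx⟩
      obtain ⟨n, hn, -⟩ := hmem f x hx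
      refine ⟨n % Function.minimalPeriod G.rot κ, by simpa using Nat.mod_lt n hpos, ?_⟩
      simp only [Function.iterate_mod_minimalPeriod_eq]
      rw [hn]
    · rintro ⟨n, -, rfl⟩
      exact ⟨_, hpt n⟩
  have hcard := hG.interior_vertex _ ⟨κ.1, κ.2, rfl⟩ hbd
  change {f : F | G.cornerPoint κ ∈ G.square f}.ncard = 4 at hcard
  rwa [hset, Set.InjOn.ncard_image, Set.ncard_coe_finset, Finset.card_range] at hcard
  -- An embedded square has only one corner at the vertex, so the orbit visits distinct squares.
  intro m hm n hn hmn
  have heq : G.rot^[m] κ = G.rot^[n] κ := by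
    refine Prod.ext hmn (hG.corner_unique (f := (G.rot^[m] κ).1) ?_)
    have h1 := hpt m
    have h2 := hpt n
    rw [← h2] at h1
    simp only at hmn
    conv_rhs => rw [hmn]
    exact h1
  exact (Function.iterate_eq_iterate_iff_of_lt_minimalPeriod (by simpa using hm)
    (by simpa using hn)).1 heq

end SquareGluing

/-! ### Covering spaces and potentials of cochains -/

namespace SquareGluing

variable {F : Type*} (G : SquareGluing F)

section Cover

variable {A : Type*} [AddCommGroup A]

/-- A cochain on the sides with values in `A`, antisymmetric under the gluing and zero on the free
sides. -/
structure SideCochain (A : Type*) [AddCommGroup A] where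
  val : F × Fin 4 → A
  val_glue : ∀ s, val (G.glue s) = -val s
  val_free : ∀ s, G.glue s = s → val s = 0

variable {G} (c : G.SideCochain A)

/-- The gluing with one copy of each square for every element of `A`, where crossing a side `s`
shifts the copy by `c s`. -/
def SideCochain.cover : SquareGluing (F × A) where
  glue s := (((G.glue (s.1.1, s.2)).1, s.1.2 + c.val (s.1.1, s.2)), (G.glue (s.1.1, s.2)).2)
  glue_involutive := by
    rintro ⟨⟨f, α⟩, i⟩
    simp [G.glue_involutive (f, i), c.val_glue]

theorem SideCochain.cover_glue (f : F) (α : A) (i : Fin 4) :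
    c.cover.glue ((f, α), i) =
      (((G.glue (f, i)).1, α + c.val (f, i)), (G.glue (f, i)).2) := rfl

theorem SideCochain.cover_glue_ne_iff {f : F} {α : A} {i : Fin 4} :
    c.cover.glue ((f, α), i) ≠ ((f, α), i) ↔ G.glue (f, i) ≠ (f, i) := by
  rw [not_iff_not, c.cover_glue]
  constructor
  · intro h
    simp only [Prod.mk.injEq] at h
    exact Prod.ext h.1.1 h.2
  · intro h
    simp [h, c.val_free _ h]

/-- The projection of the cover to the original space. -/
def SideCochain.proj : c.cover.Space → G.Space :=
  Quot.lift (fun p => G.chart p.1.1 p.2) (by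
    rintro _ _ ⟨⟨f, α⟩, i, t, h, rfl, rfl⟩
    exact G.chart_glue (c.cover_glue_ne_iff.1 h) t)

@[simp] theorem SideCochain.proj_chart (f : F) (α : A) (x : ModelSquare) :
    c.proj (c.cover.chart (f, α) x) = G.chart f x := rfl

/-- The translation of the copies by an element of `A`. -/
def SideCochain.translate (α : A) : c.cover.Space → c.cover.Space :=
  Quot.lift (fun p => c.cover.chart (p.1.1, α + p.1.2) p.2) (by
    rintro _ _ ⟨⟨f, β⟩, i, t, h, rfl, rfl⟩
    have h' : c.cover.glue ((f, α + β), i) ≠ ((f, α + β), i) :=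
      c.cover_glue_ne_iff.2 (c.cover_glue_ne_iff.1 h)
    simpa [c.cover_glue, add_assoc] using c.cover.chart_glue h' t)

@[simp] theorem SideCochain.translate_chart (α : A) (f : F) (β : A) (x : ModelSquare) :
    c.translate α (c.cover.chart (f, β) x) = c.cover.chart (f, α + β) x := rfl

theorem exists_chart_eq (e : G.Space) : ∃ f x, e = G.chart f x := by
  induction e using Quot.ind with
  | mk p => exact ⟨p.1, p.2, rfl⟩

theorem SideCochain.exists_chart_eq (e : c.cover.Space) :
    ∃ f α x, e = c.cover.chart (f, α) x := by
  obtain ⟨⟨f, α⟩, x, h⟩ := SquareGluing.exists_chart_eq e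
  exact ⟨f, α, x, h⟩

instance : AddAction A c.cover.Space where
  vadd := c.translate
  zero_vadd e := by
    obtain ⟨f, α, x, rfl⟩ := c.exists_chart_eq e
    exact (c.translate_chart 0 f α x).trans (by rw [zero_add])
  add_vadd α β e := by
    obtain ⟨f, γ, x, rfl⟩ := c.exists_chart_eq e
    change c.translate _ _ = c.translate _ (c.translate _ _)
    simp [add_assoc]

theorem SideCochain.vadd_chart (α : A) (f : F) (β : A) (x : ModelSquare) :
    α +ᵥ c.cover.chart (f, β) x = c.cover.chart (f, α + β) x := rfl

/-- The function `a` is a local trivialization: over the star of a vertex, the corner stars in the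
copies `a κ + δ` fit together into one sheet for each `δ`. Distinct sheets are disjoint because a
square has only one corner at the vertex. At a free corner no side is crossed, so nothing is
required there. -/
theorem SideCochain.isAddQuotientCoveringMap (hG : G.IsQuadriculatedDisk) (a : F × Fin 4 → A)
    (ha : ∀ κ, ¬ G.FreeCorner κ → a κ - a (G.rot κ) = c.val (G.rot κ)) :
    IsAddQuotientCoveringMap c.proj A where
  surjective e := by
    obtain ⟨f, x, rfl⟩ := SquareGluing.exists_chart_eq e
    exact ⟨c.cover.chart (f, 0) x, rfl⟩
  eq_coinduced := by
    have hq : IsQuotientMap (Quot.mk G.Attach) := isQuotientMap_quot_mk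
    have hcont : Continuous c.proj :=
      continuous_quot_lift _ (continuous_sigma fun p => G.continuous_chart p.1)
    refine (IsQuotientMap.of_comp (f := fun p : (_ : F) × ModelSquare =>
      c.cover.chart (p.1, 0) p.2) ?_ hcont hq).eq_coinduced
    exact continuous_sigma fun f => c.cover.continuous_chart (f, 0)
  continuous_const_vadd α :=
    continuous_quot_lift _ (continuous_sigma fun p => c.cover.continuous_chart (p.1, α + p.2))
  apply_eq_iff_mem_orbit := by
    intro e₁ e₂
    obtain ⟨f, α, x, rfl⟩ := c.exists_chart_eq e₁
    obtain ⟨g, β, y, rfl⟩ := c.exists_chart_eq e₂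
    constructor
    · intro h
      let P : ((_ : F) × ModelSquare) → Prop :=
        fun p => ∃ γ : A, c.cover.chart (p.1, γ) p.2 = c.cover.chart (f, α) x
      have hP : ∀ p q, G.Attach p q → P p → P q := by
        rintro _ _ ⟨f', i, t, hne, rfl, rfl⟩ ⟨γ, hγ⟩
        refine ⟨γ + c.val (f', i), ?_⟩
        rw [← hγ]
        exact (c.cover.chart_glue (c.cover_glue_ne_iff.2 hne) t).symm
      obtain ⟨γ, hγ⟩ := G.mk_mem_iff_of_attach hP (p := ⟨f, x⟩) (q := ⟨g, y⟩) h ⟨α, rfl⟩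
      refine ⟨γ - β, ?_⟩
      change c.translate _ _ = _
      simpa using hγ
    · rintro ⟨γ, hγ⟩
      rw [← hγ]
      rfl
  disjoint := by
    intro e
    obtain ⟨f₀, α₀, x₀, rfl⟩ := c.exists_chart_eq e
    obtain ⟨i₀, hi₀⟩ := exists_mem_cornerStar x₀
    let P : A → ((_ : F × A) × ModelSquare) → Prop := fun δ p =>
      ∃ i, G.cornerPoint (p.1.1, i) = G.cornerPoint (f₀, i₀) ∧ p.2 ∈ cornerStar i ∧
        p.1.2 = a (p.1.1, i) + δ
    have hP : ∀ δ p q, c.cover.Attach p q → P δ p → P δ q := by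
      rintro δ _ _ ⟨⟨f, α⟩, i, t, hne, rfl, rfl⟩ ⟨k, hk, hx, hα⟩
      have hne' := c.cover_glue_ne_iff.1 hne
      rcases sidePoint_mem_cornerStar.1 hx with ⟨rfl, ht⟩ | ⟨rfl, ht⟩
      · refine ⟨(G.glue (f, k)).2 + 1, ?_, ?_, ?_⟩
        · exact (G.cornerPoint_glue_succ hne').trans hk
        · exact sidePoint_mem_cornerStar.2 (.inr ⟨rfl, unitInterval.symm_pos_iff.2 ht⟩)
        · have h2 : ¬ G.FreeCorner ((G.glue (f, k)).1, (G.glue (f, k)).2 + 1) := by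
            simpa [FreeCorner, G.glue_involutive (f, k)] using hne'.symm
          have := ha _ h2
          rw [G.rot_glue_succ, sub_eq_iff_eq_add] at this
          simp only [c.cover_glue] at hα ⊢
          rw [this, hα]
          abel
      · refine ⟨(G.glue (f, i)).2, ?_, ?_, ?_⟩
        · exact (G.cornerPoint_glue hne').trans hk
        · exact sidePoint_mem_cornerStar.2 (.inl ⟨rfl, unitInterval.symm_lt_one_iff.2 ht⟩)
        · have h2 : ¬ G.FreeCorner (f, i + 1) := by simpa [FreeCorner] using hne'
          have := ha _ h2
          rw [G.rot_succ, c.val_glue, sub_eq_iff_eq_add] at this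
          simp only [c.cover_glue] at hα ⊢
          rw [hα, this]
          simp only [Prod.mk.eta]
          abel
    let U : Set c.cover.Space := {e | ∃ p, P (α₀ - a (f₀, i₀)) p ∧ e = Quot.mk _ p}
    have hU : ∀ p, Quot.mk _ p ∈ U ↔ P (α₀ - a (f₀, i₀)) p := fun p =>
      ⟨fun ⟨q, hq, h⟩ => c.cover.mk_mem_iff_of_attach (hP _) h.symm hq, fun h => ⟨p, h, rfl⟩⟩
    refine ⟨U, IsOpen.mem_nhds ?_ ((hU ⟨(f₀, α₀), x₀⟩).2 ⟨i₀, rfl, hi₀, by simp⟩), ?_⟩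
    · refine (isQuotientMap_quot_mk (r := c.cover.Attach)).isOpen_preimage.1 ?_
      refine isOpen_sigma_iff.2 fun p => ?_
      change IsOpen {x : ModelSquare | Quot.mk c.cover.Attach ⟨p, x⟩ ∈ U}
      have : {x : ModelSquare | Quot.mk c.cover.Attach ⟨p, x⟩ ∈ U} =
          ⋃ i ∈ {i | G.cornerPoint (p.1, i) = G.cornerPoint (f₀, i₀) ∧
            p.2 = a (p.1, i) + (α₀ - a (f₀, i₀))}, cornerStar i := by
        ext x
        simp only [hU, P, Set.mem_iUnion, Set.mem_ofPred_eq, exists_prop]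
        exact exists_congr fun i => by tauto
      rw [this]
      exact isOpen_biUnion fun i _ => isOpen_cornerStar i
    · rintro δ ⟨e, ⟨e', he', rfl⟩, he⟩
      obtain ⟨f, α, x, rfl⟩ := c.exists_chart_eq e'
      obtain ⟨i, hi, -, hα⟩ := (hU ⟨(f, α), x⟩).1 he'
      obtain ⟨j, hj, -, hδ⟩ := (hU ⟨(f, δ + α), x⟩).1 he
      obtain rfl := hG.corner_unique (hi.trans hj.symm)
      simp only at hα hδ
      rw [← hα, add_eq_right] at hδ
      exact hδ

/-- A cochain that is exact around every vertex is exact on a quadriculated disk. -/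
theorem SideCochain.exists_potential (hG : G.IsQuadriculatedDisk) (a : F × Fin 4 → A)
    (ha : ∀ κ, ¬ G.FreeCorner κ → a κ - a (G.rot κ) = c.val (G.rot κ)) :
    ∃ n : F → A, ∀ s, n (G.glue s).1 = n s.1 + c.val s := by
  have hq := c.isAddQuotientCoveringMap hG a ha
  have hcov := hq.isCoveringMap
  obtain ⟨Φ⟩ := hG.homeomorph_disk
  have hconv := convex_closedBall (0 : EuclideanSpace ℝ (Fin 2)) 1
  have : ContractibleSpace (Metric.closedBall (0 : EuclideanSpace ℝ (Fin 2)) 1) :=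
    hconv.contractibleSpace ⟨0, by simp⟩
  have : LocallyPathConnectedSpace (Metric.closedBall (0 : EuclideanSpace ℝ (Fin 2)) 1) :=
    hconv.locallyPathConnectedSpace
  let o : Metric.closedBall (0 : EuclideanSpace ℝ (Fin 2)) 1 := ⟨0, by simp⟩
  obtain ⟨e₀, he₀⟩ := hq.surjective (Φ.symm o)
  -- The disk is simply connected, so `Φ.symm` lifts. The lift gives a section of the cover, and `n
  -- f` is the copy of `f` in which it runs.
  obtain ⟨S, ⟨-, hS⟩, -⟩ :=
    hcov.existsUnique_continuousMap_lifts ⟨Φ.symm, Φ.symm.continuous⟩ o e₀ he₀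
  have hS' : ∀ x : G.Space, c.proj (S (Φ x)) = x := fun x => by
    simpa using congrFun hS (Φ x)
  have key : ∀ f, ∃ α : A, ∀ x, S (Φ (G.chart f x)) = c.cover.chart (f, α) x := by
    intro f
    obtain ⟨α, hα⟩ := hq.apply_eq_iff_mem_orbit.1
      ((hS' (G.chart f 0)).trans (c.proj_chart f 0 0).symm)
    refine ⟨α, fun x => ?_⟩
    refine congrFun (hcov.eq_of_comp_eq (g₁ := fun x => S (Φ (G.chart f x)))
      (S.continuous.comp (Φ.continuous.comp (G.continuous_chart f)))
      (c.cover.continuous_chart (f, α)) ?_ 0 ?_) x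
    · ext x
      exact hS' _
    · refine hα.symm.trans ?_
      change α +ᵥ _ = _
      rw [c.vadd_chart, add_zero]
  choose n hn using key
  refine ⟨n, fun ⟨f, i⟩ => ?_⟩
  by_cases hfree : G.glue (f, i) = (f, i)
  · rw [hfree, c.val_free _ hfree, add_zero]
  have h1 := hn f (sidePoint i 0)
  rw [G.chart_glue hfree 0, hn] at h1
  have h2 := c.cover.chart_glue (f := (f, n f)) (i := i) (c.cover_glue_ne_iff.2 hfree) 0
  rw [h2, c.cover_glue] at h1
  have hcancel := hq.isCancelVAdd
  have h3 : ∀ α, c.cover.chart ((G.glue (f, i)).1, α)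
      (sidePoint (G.glue (f, i)).2 (unitInterval.symm 0)) = α +ᵥ
      c.cover.chart ((G.glue (f, i)).1, 0) (sidePoint (G.glue (f, i)).2 (unitInterval.symm 0)) :=
    fun α => by rw [c.vadd_chart, add_zero]
  simp only at h1
  rw [h3, h3 (n f + _)] at h1
  exact IsCancelVAdd.right_cancel _ _ _ h1

end Cover

end SquareGluing

/-- A function on the points of a finite permutation, outside a set `S`, is the difference of a
potential if its sum over every cycle that avoids `S` is zero. -/
theorem Equiv.Perm.exists_sub_apply_eq {X A : Type*} [Finite X] [AddCommGroup A]
    (P : Equiv.Perm X) (S : Set X) (s : X → A)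
    (h : ∀ x, (∀ n, P^[n] x ∉ S) →
      ∑ k ∈ Finset.range (Function.minimalPeriod P x), s (P^[k] x) = 0) :
    ∃ a : X → A, ∀ x, x ∉ S → a x - a (P x) = s x := by
  classical
  let rep : X → X := fun x => (Quotient.mk (Equiv.Perm.SameCycle.setoid P) x).out
  have hrep : ∀ x, P.SameCycle x (rep x) := fun x =>
    (Quotient.exact (Quotient.out_eq (Quotient.mk (Equiv.Perm.SameCycle.setoid P) x))).symm
  have hrepP : ∀ x n, rep (P^[n] x) = rep x := fun x n => by
    have : P.SameCycle (P^[n] x) x := by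
      rw [← Equiv.Perm.coe_pow]
      exact Equiv.Perm.sameCycle_pow_left.2 (Equiv.Perm.SameCycle.refl P x)
    exact congrArg Quotient.out (Quotient.sound this)
  -- A cycle that avoids `S` is cut at one chosen representative. The potential at `x` is the sum of
  -- `s` from `x` up to, but excluding, the next stop; the hypothesis is needed only at a
  -- representative, where the path goes once round the cycle.
  let Stop : X → Prop := fun x => x ∈ S ∨ (x = rep x ∧ ∀ n, P^[n] x ∉ S)
  have hStop : ∀ x, ∃ n, Stop (P^[n] x) := by
    intro x
    by_cases hx : ∃ n, P^[n] x ∈ S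
    · exact hx.imp fun n hn => Or.inl hn
    · push Not at hx
      obtain ⟨n, hn⟩ := (hrep x).exists_nat_pow_eq
      refine ⟨n, Or.inr ⟨?_, fun m => ?_⟩⟩
      · rw [hrepP, ← hn, Equiv.Perm.coe_pow]
      · rw [← Function.iterate_add_apply]
        exact hx _
  refine ⟨fun x => ∑ k ∈ Finset.range (Nat.find (hStop x)), s (P^[k] x), fun x hx => ?_⟩
  simp only
  by_cases hs : Stop x
  · obtain ⟨hx1, hx2⟩ := hs.resolve_left hx
    have h0 : Nat.find (hStop x) = 0 := (Nat.find_eq_zero _).2 hs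
    have hper : x ∈ Function.periodicPts P := by
      have : Fintype X := Fintype.ofFinite X
      exact P.injective.mem_periodicPts x
    have hiff : ∀ n, Stop (P^[n] (P x)) ↔ P^[n + 1] x = x := by
      intro n
      rw [← Function.iterate_succ_apply]
      constructor
      · rintro (h' | ⟨h', -⟩)
        · exact absurd h' (hx2 _)
        · rw [h', hrepP, ← hx1]
      · intro h'
        rw [Nat.succ_eq_add_one, h']
        exact hs
    have h1 : Nat.find (hStop (P x)) + 1 = Function.minimalPeriod P x := by
      apply le_antisymm
      · have hpos := Function.minimalPeriod_pos_of_mem_periodicPts hper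
        have : Nat.find (hStop (P x)) ≤ Function.minimalPeriod P x - 1 := by
          refine Nat.find_le ?_
          rw [hiff, Nat.sub_add_cancel hpos]
          exact Function.iterate_minimalPeriod
        omega
      · refine Function.IsPeriodicPt.minimalPeriod_le (Nat.succ_pos _) ?_
        exact (hiff _).1 (Nat.find_spec (hStop (P x)))
    have := h x hx2
    rw [← h1, Finset.sum_range_succ'] at this
    simp only [Function.iterate_succ_apply, Function.iterate_zero, id] at this
    rw [h0, Finset.range_zero, Finset.sum_empty, zero_sub, neg_eq_iff_add_eq_zero, this]
  · have h1 : Nat.find (hStop x) = Nat.find (hStop (P x)) + 1 := by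
      refine (Nat.find_eq_iff _).2 ⟨?_, fun n hn => ?_⟩
      · exact Nat.find_spec (hStop (P x))
      · rcases n with _ | n
        · exact hs
        · exact Nat.find_min (hStop (P x)) (by omega)
    rw [h1, Finset.sum_range_succ']
    simp

namespace SquareGluing

variable {F : Type*} {G : SquareGluing F}

theorem freeCorner_iff_glue_rot (κ : F × Fin 4) :
    G.FreeCorner κ ↔ G.glue (G.rot κ) = G.rot κ := by
  obtain ⟨f, i⟩ := κ
  rw [rot_apply, G.glue_involutive]
  exact eq_comm

theorem glue_rot (κ : F × Fin 4) : G.glue (G.rot κ) = (κ.1, κ.2 - 1) := by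
  obtain ⟨f, i⟩ := κ
  rw [rot_apply, G.glue_involutive]

/-- On a quadriculated disk, a function on sides that changes sign under the gluing is the
difference of a potential if it adds up to zero around each interior vertex. -/
theorem IsQuadriculatedDisk.exists_potential [Finite F] {A : Type*} [AddCommGroup A]
    (hG : G.IsQuadriculatedDisk) (c : F × Fin 4 → A)
    (hc : ∀ s, G.glue s ≠ s → c (G.glue s) = -c s)
    (hv : ∀ κ, (∀ n, ¬ G.FreeCorner (G.rot^[n] κ)) → Function.minimalPeriod G.rot κ = 4 →
      c κ + c (G.rot κ) + c (G.rot (G.rot κ)) + c (G.rot (G.rot (G.rot κ))) = 0) :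
    ∃ n : F → A, ∀ s, G.glue s ≠ s → n (G.glue s).1 = n s.1 + c s := by
  classical
  let C : G.SideCochain A :=
    { val := fun s => if G.glue s = s then 0 else c s
      val_glue := fun s => by
        by_cases h : G.glue s = s
        · simp [h]
        · have h' : ¬ G.glue (G.glue s) = G.glue s := by
            rw [G.glue_involutive]; exact fun h' => h h'.symm
          rw [if_neg h', if_neg h, hc s h]
      val_free := fun s hs => if_pos hs }
  have hC : ∀ s, G.glue s ≠ s → C.val s = c s := fun s hs => if_neg hs
  -- Cycles through a free corner impose no condition; the others belong to interior vertices and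
  -- have length four.
  obtain ⟨a, ha⟩ := G.rot.exists_sub_apply_eq {κ | G.FreeCorner κ} (fun κ => C.val (G.rot κ)) (by
    intro κ hκ
    have h4 := hG.minimalPeriod_rot hκ
    have hit : G.rot (G.rot (G.rot (G.rot κ))) = κ := by
      have := Function.iterate_minimalPeriod (f := G.rot) (x := κ)
      rwa [h4] at this
    have hval : ∀ n, C.val (G.rot (G.rot^[n] κ)) = c (G.rot (G.rot^[n] κ)) := fun n =>
      hC _ (mt (freeCorner_iff_glue_rot _).2 (hκ n))
    have := hv κ hκ h4
    simp only [h4, hval, Finset.sum_range_succ, Finset.sum_range_zero, Function.iterate_succ,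
      Function.iterate_zero, Function.comp, id, hit, zero_add]
    rw [← this]
    abel)
  obtain ⟨n, hn⟩ := C.exists_potential hG a ha
  exact ⟨n, fun s hs => by rw [hn, hC s hs]⟩

/-! ### The developing map into the grid, and the signs -/

/-- The unit vectors of the plane, in counterclockwise order. -/
def unitStep : Fin 4 → ℤ × ℤ
  | 0 => (0, -1)
  | 1 => (1, 0)
  | 2 => (0, 1)
  | 3 => (-1, 0)

/-- The developing map: the squares have positions in the plane such that crossing a side is a unit
step, in a direction that turns with the side. -/
theorem IsQuadriculatedDisk.exists_position [Finite F] (hG : G.IsQuadriculatedDisk) :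
    ∃ (r : F → Fin 4) (pos : F → ℤ × ℤ), ∀ s, G.glue s ≠ s →
      pos (G.glue s).1 = pos s.1 + unitStep (s.2 + r s.1) := by
  have hrot4 : ∀ κ, Function.minimalPeriod G.rot κ = 4 →
      G.rot (G.rot (G.rot (G.rot κ))) = κ := fun κ h4 => by
    have := Function.iterate_minimalPeriod (f := G.rot) (x := κ)
    rwa [h4] at this
  -- `r` is the quarter turn from the frame of a square to that of the grid. Glued sides must have
  -- opposite outward directions, whence the `2`. Around an interior vertex the indices telescope
  -- and each crossing leaves a `3`, so four crossings give `12 = 0` in `Fin 4`.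
  obtain ⟨r, hr⟩ := hG.exists_potential (A := Fin 4) (fun s => s.2 - (G.glue s).2 + 2)
    (fun s _ => by
      simp only [G.glue_involutive s]
      generalize s.2 = i, (G.glue s).2 = j
      revert i j
      decide)
    (fun κ _ h4 => by
      have h0 : G.glue κ = ((G.rot (G.rot (G.rot κ))).1, (G.rot (G.rot (G.rot κ))).2 - 1) := by
        rw [← glue_rot, hrot4 κ h4]
      simp only [glue_rot, h0]
      generalize κ.2 = i0, (G.rot κ).2 = i1, (G.rot (G.rot κ)).2 = i2,
        (G.rot (G.rot (G.rot κ))).2 = i3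
      revert i0 i1 i2 i3
      decide)
  have hdir : ∀ s, G.glue s ≠ s → (G.glue s).2 + r (G.glue s).1 = s.2 + r s.1 + 2 := by
    intro s hs
    rw [hr s hs]
    generalize s.2 = i, (G.glue s).2 = j, r s.1 = k
    revert i j k
    decide
  have hneg : ∀ d, unitStep (d + 2) = -unitStep d := by decide
  have hsum : ∀ d, unitStep d + unitStep (d + 1) + unitStep (d + 1 + 1) +
      unitStep (d + 1 + 1 + 1) = 0 := by decide
  -- The direction advances by a quarter turn at each crossing about a vertex, so the four steps
  -- cancel.
  obtain ⟨pos, hpos⟩ := hG.exists_potential (fun s => unitStep (s.2 + r s.1))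
    (fun s hs => by simp only [hdir s hs, hneg])
    (fun κ hκ _ => by
      have hstep : ∀ n, (G.rot (G.rot^[n] κ)).2 + r (G.rot (G.rot^[n] κ)).1 =
          (G.rot^[n] κ).2 + r (G.rot^[n] κ).1 + 1 := by
        intro n
        have := hdir _ (hκ n)
        rw [show G.glue ((G.rot^[n] κ).1, (G.rot^[n] κ).2 - 1) = G.rot (G.rot^[n] κ) from rfl]
          at this
        rw [this]
        change (G.rot^[n] κ).2 - 1 + r (G.rot^[n] κ).1 + 2 = _
        generalize (G.rot^[n] κ).2 = i, r (G.rot^[n] κ).1 = j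
        revert i j
        decide
      have h0 := hstep 0
      have h1 := hstep 1
      have h2 := hstep 2
      simp only [Function.iterate_succ, Function.iterate_zero, Function.comp, id] at h0 h1 h2
      simp only [h2, h1, h0]
      exact hsum _)
  exact ⟨r, pos, hpos⟩

/-- Two squares of a quadriculated disk share at most one side. -/
theorem IsQuadriculatedDisk.side_unique [Finite F] (hG : G.IsQuadriculatedDisk) {f : F}
    {i j : Fin 4} (hi : G.glue (f, i) ≠ (f, i)) (hj : G.glue (f, j) ≠ (f, j))
    (h : (G.glue (f, i)).1 = (G.glue (f, j)).1) : i = j := by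
  obtain ⟨r, pos, hpos⟩ := hG.exists_position
  have h1 := hpos _ hi
  rw [h, hpos _ hj, add_right_inj] at h1
  have hinj : ∀ i j k : Fin 4, unitStep (j + k) = unitStep (i + k) → i = j := by decide
  exact hinj _ _ _ h1

/-- Signs on the squares that alternate around every square. -/
theorem IsQuadriculatedDisk.exists_sign [Finite F] (hG : G.IsQuadriculatedDisk) :
    ∃ σ τ : F → ℤˣ, ∀ s, G.glue s ≠ s → σ (G.glue s).1 = τ s.1 * (-1) ^ (s.2 : ℕ) := by
  obtain ⟨r, pos, hpos⟩ := hG.exists_position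
  -- `σ` is the parity of the column. It changes exactly when `s.2 + r s.1` is odd, which factors
  -- into a sign of the square and a sign of the side.
  refine ⟨fun f => (pos f).1.negOnePow, fun f => (pos f).1.negOnePow * (-1) ^ (r f : ℕ),
    fun s hs => ?_⟩
  have hsign : ∀ i k : Fin 4, (unitStep (i + k)).1.negOnePow =
      (-1) ^ (k : ℕ) * (-1) ^ (i : ℕ) := by decide
  simp only
  rw [hpos s hs, Prod.fst_add, Int.negOnePow_add, hsign, mul_assoc]

end SquareGluing

/-! ### The boundary is a single cycle -/

namespace SquareGluing

variable {F : Type*} {G : SquareGluing F}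

/-- The differences along the sides of a function on the corners. -/
def sideDiff (F : Type*) : (F × Fin 4 → ℚ) →ₗ[ℚ] (F × Fin 4 → ℚ) where
  toFun w s := w (s.1, s.2 + 1) - w s
  map_add' w w' := by ext s; simp; ring
  map_smul' r w := by ext s; simp; ring

theorem sideDiff_apply (w : F × Fin 4 → ℚ) (s : F × Fin 4) :
    sideDiff F w s = w (s.1, s.2 + 1) - w s := rfl

theorem apply_glue_of_rot_invariant {X : Type*} {w : F × Fin 4 → X}
    (hw : ∀ κ, w (G.rot κ) = w κ) (s : F × Fin 4) : w (G.glue s) = w (s.1, s.2 + 1) := by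
  rw [glue_eq_rot_succ, hw]

theorem sideDiff_glue {w : F × Fin 4 → ℚ} (hw : ∀ κ, w (G.rot κ) = w κ) (s : F × Fin 4) :
    sideDiff F w (G.glue s) = -sideDiff F w s := by
  rw [sideDiff_apply, sideDiff_apply, ← hw ((G.glue s).1, _), rot_glue_succ,
    apply_glue_of_rot_invariant hw]
  ring

theorem sum_comp_glue [Fintype F] (u : F × Fin 4 → ℚ) : ∑ s, u (G.glue s) = ∑ s, u s :=
  Equiv.sum_comp G.glue_involutive.toPerm u

/-- The corner functions that come from functions on the interior vertices. -/
def interiorFunctions (G : SquareGluing F) : Submodule ℚ (F × Fin 4 → ℚ) where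
  carrier := {w | (∀ κ, w (G.rot κ) = w κ) ∧ ∀ κ, G.FreeCorner κ → w κ = 0}
  add_mem' := by
    rintro w w' ⟨h1, h2⟩ ⟨h1', h2'⟩
    exact ⟨fun κ => by simp [h1, h1'], fun κ hκ => by simp [h2 κ hκ, h2' κ hκ]⟩
  zero_mem' := ⟨fun _ => rfl, fun _ _ => rfl⟩
  smul_mem' := by
    rintro r w ⟨h1, h2⟩
    exact ⟨fun κ => by simp [h1], fun κ hκ => by simp [h2 κ hκ]⟩

/-- On a quadriculated disk, the differences of a function on the vertices that is constant along
the boundary are those of a function supported on the interior vertices. -/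
theorem IsQuadriculatedDisk.sideDiff_mem_map [Fintype F] (hG : G.IsQuadriculatedDisk)
    {w : F × Fin 4 → ℚ} (hw : ∀ κ, w (G.rot κ) = w κ) :
    sideDiff F w ∈ G.interiorFunctions.map (sideDiff F) := by
  classical
  by_contra hmem
  -- Duality: the antisymmetrized coefficients `c` of a functional that kills the interior functions
  -- add up to zero around interior vertices, hence are exact. An exact `c` pairs to zero with
  -- `sideDiff F w`, whose values add up to zero around each square.
  obtain ⟨φ, hφz, hφ⟩ := Submodule.exists_le_ker_of_notMem hmem
  let b : F × Fin 4 → ℚ := fun s => φ (Pi.single s 1)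
  have hb : ∀ u, φ u = ∑ s, b s * u s := by
    intro u
    rw [LinearMap.pi_apply_eq_sum_univ φ u]
    refine Finset.sum_congr rfl fun s _ => ?_
    rw [smul_eq_mul, mul_comm]
    congr 2
    ext x
    simp [Pi.single_apply, eq_comm]
  let c : F × Fin 4 → ℚ := fun s => b s - b (G.glue s)
  have hcneg : ∀ s, c (G.glue s) = -c s := fun s => by
    simp only [c, G.glue_involutive s]
    ring
  have hcφ : ∀ u : F × Fin 4 → ℚ, (∀ s, u (G.glue s) = -u s) → ∑ s, c s * u s = 2 * φ u := by
    intro u hu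
    have h1 : ∑ s, b (G.glue s) * u s = -∑ s, b s * u s := by
      rw [← sum_comp_glue (G := G), ← Finset.sum_neg_distrib]
      refine Finset.sum_congr rfl fun s _ => ?_
      rw [G.glue_involutive, hu]
      ring
    simp only [c, sub_mul, Finset.sum_sub_distrib, h1, hb]
    ring
  obtain ⟨n, hn⟩ := hG.exists_potential c (fun s _ => hcneg s) (by
    intro κ hκ h4
    have hit : G.rot (G.rot (G.rot (G.rot κ))) = κ := by
      have := Function.iterate_minimalPeriod (f := G.rot) (x := κ)
      rwa [h4] at this
    -- The indicator of one interior vertex, as a function on its four corners.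
    let w' : F × Fin 4 → ℚ := fun x =>
      (if x = κ then 1 else 0) + (if x = G.rot κ then 1 else 0) +
      (if x = G.rot (G.rot κ) then 1 else 0) + (if x = G.rot (G.rot (G.rot κ)) then 1 else 0)
    have hw' : ∀ x, w' (G.rot x) = w' x := by
      intro x
      have h0 : G.rot x = κ ↔ x = G.rot (G.rot (G.rot κ)) := by
        rw [← G.rot.injective.eq_iff (b := G.rot _), hit]
      simp only [w', h0, G.rot.injective.eq_iff]
      ring
    have hfree : ∀ x, G.FreeCorner x → w' x = 0 := by
      intro x hx
      have h0 : x ≠ κ := fun h => hκ 0 (h ▸ hx)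
      have h1 : x ≠ G.rot κ := fun h => hκ 1 (by subst h; exact hx)
      have h2 : x ≠ G.rot (G.rot κ) := fun h => hκ 2 (by subst h; exact hx)
      have h3 : x ≠ G.rot (G.rot (G.rot κ)) := fun h => hκ 3 (by subst h; exact hx)
      simp [w', h0, h1, h2, h3]
    have hzero : φ (sideDiff F w') = 0 := hφ ⟨w', ⟨hw', hfree⟩, rfl⟩
    have h1 := hcφ _ (sideDiff_glue hw')
    have h2 : ∑ s, c s * w' (s.1, s.2 + 1) = -∑ s, c s * w' s := by
      rw [← Finset.sum_neg_distrib, ← sum_comp_glue (G := G)]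
      refine Finset.sum_congr rfl fun s _ => ?_
      rw [hcneg, ← apply_glue_of_rot_invariant hw', G.glue_involutive]
      ring
    simp only [sideDiff_apply, mul_sub, Finset.sum_sub_distrib, h2, hzero, mul_zero] at h1
    have h3 : ∑ s, c s * w' s = 0 := by linarith
    simpa [w', mul_add, Finset.sum_add_distrib] using h3)
  have hn' : ∀ s, c s = n (G.glue s).1 - n s.1 := fun s => by
    by_cases hs : G.glue s = s
    · simp [c, hs]
    · rw [hn s hs]; ring
  have hz := sideDiff_glue hw
  have h1 : ∑ s, n (G.glue s).1 * sideDiff F w s = -∑ s, n s.1 * sideDiff F w s := by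
    rw [← Finset.sum_neg_distrib, ← sum_comp_glue (G := G)]
    refine Finset.sum_congr rfl fun s _ => ?_
    rw [G.glue_involutive, hz]
    ring
  have h2 : ∑ s, n s.1 * sideDiff F w s = 0 := by
    rw [Fintype.sum_prod_type]
    refine Finset.sum_eq_zero fun f _ => ?_
    simp only [← Finset.mul_sum]
    have : ∑ i : Fin 4, sideDiff F w (f, i) = 0 := by
      simp only [sideDiff_apply, Finset.sum_sub_distrib]
      rw [sub_eq_zero]
      exact Equiv.sum_comp (Equiv.addRight (1 : Fin 4)) fun i => w (f, i)
    rw [this, mul_zero]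
  have h3 := hcφ _ hz
  simp only [hn', sub_mul, Finset.sum_sub_distrib, h1, h2] at h3
  apply hφz
  linarith

/-- The boundary of a quadriculated disk is a single cycle. -/
theorem IsQuadriculatedDisk.sameCycle_rot [Fintype F] (hG : G.IsQuadriculatedDisk)
    {κ₁ κ₂ : F × Fin 4} (h₁ : G.FreeCorner κ₁) (h₂ : G.FreeCorner κ₂) :
    G.rot.SameCycle κ₁ κ₂ := by
  classical
  by_contra hnot
  -- The indicator of one cycle. Subtracting an interior function with the same side differences
  -- leaves a function constant on the disk, yet equal to `1` at `κ₁` and `0` at `κ₂`.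
  let w : F × Fin 4 → ℚ := fun κ => if G.rot.SameCycle κ₁ κ then 1 else 0
  have hw : ∀ κ, w (G.rot κ) = w κ := fun κ => by simp [w, Equiv.Perm.sameCycle_apply_right]
  obtain ⟨w', ⟨hw', hfree⟩, hdiff⟩ := hG.sideDiff_mem_map hw
  let u : F × Fin 4 → ℚ := fun κ => w κ - w' κ
  have hu : ∀ κ, u (G.rot κ) = u κ := fun κ => by simp only [u, hw, hw']
  have hsucc : ∀ f i, u (f, i + 1) = u (f, i) := fun f i => by
    have := congrFun hdiff (f, i)
    simp only [sideDiff_apply] at this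
    simp only [u]
    linarith
  have hconst : ∀ f i, u (f, i) = u (f, 0) := fun f i => by
    have h0 := hsucc f 0
    have h1 := hsucc f 1
    have h2 := hsucc f 2
    fin_cases i
    · rfl
    · exact h0
    · exact h1.trans h0
    · exact h2.trans (h1.trans h0)
  have := hG.eq_of_glue (fun f => u (f, 0)) (fun s => by
    rw [← hconst _ (G.glue s).2, ← hconst _ (s.2 + 1)]
    exact apply_glue_of_rot_invariant hu s) κ₁.1 κ₂.1
  rw [← hconst _ κ₁.2, ← hconst _ κ₂.2] at this
  simp [u, w, hfree _ h₁, hfree _ h₂, hnot, Equiv.Perm.SameCycle.refl] at this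

end SquareGluing

/-! ### Flows on graphs, and segments of a permutation -/

/-- If a finite graph with edges `e` from `s e` to `t e` carries a nonzero flow with values in some
abelian group, then it carries a nonzero integral flow. Conservation at the nodes is tested against
integral functions on the nodes. -/
theorem exists_int_flow_of_flow {E N A : Type*} [AddCommGroup A] (S : Finset E) (s t : E → N)
    (x : E → A) (hx : ∀ χ : N → ℤ, ∑ e ∈ S, (χ (s e) - χ (t e)) • x e = 0)
    (hne : ∃ e ∈ S, x e ≠ 0) :
    ∃ y : E → ℤ, (∀ χ : N → ℤ, ∑ e ∈ S, (χ (s e) - χ (t e)) * y e = 0) ∧ ∃ e ∈ S, y e ≠ 0 := by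
  classical
  induction S using Finset.induction_on generalizing s t x with
  | empty => simp at hne
  | insert e S he ih =>
    -- A loop carries a flow by itself; any other edge is contracted.
    by_cases hst : s e = t e
    · refine ⟨Pi.single e 1, fun χ => Finset.sum_eq_zero fun e' _ => ?_, e, by simp, by simp⟩
      by_cases h : e' = e
      · simp [h, hst]
      · simp [h]
    · let merge : N → N := fun ν => if ν = s e then t e else ν
      have hmerge : merge (s e) = merge (t e) := by simp [merge]
      obtain ⟨y, hy, e', he', hye'⟩ := ih (merge ∘ s) (merge ∘ t) x (fun χ => by
        have := hx (χ ∘ merge)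
        rw [Finset.sum_insert he] at this
        simpa [hmerge] using this) (by
        by_contra hzero
        push Not at hzero
        obtain ⟨e', he', hxe'⟩ := hne
        rcases Finset.mem_insert.1 he' with rfl | h
        -- If the contracted edge alone carried flow, conservation at its source would make that
        -- flow zero.
        · have := hx (Pi.single (s e') 1)
          rw [Finset.sum_insert he,
            Finset.sum_eq_zero (fun e'' h'' => by rw [hzero _ h'', smul_zero])] at this
          apply hxe'
          simpa [Ne.symm hst] using this
        · exact hxe' (hzero _ h))
      -- The net outflow of the other edges at `s e`. The value `-k` on `e` balances this node, and
      -- then `t e` as well, since the merged node is balanced.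
      let k : ℤ := ∑ e' ∈ S,
        ((Pi.single (s e) 1 : N → ℤ) (s e') - (Pi.single (s e) 1 : N → ℤ) (t e')) * y e'
      refine ⟨Function.update y e (-k), fun χ => ?_, e', Finset.mem_insert_of_mem he', ?_⟩
      · have hS : ∑ e' ∈ S, (χ (s e') - χ (t e')) * Function.update y e (-k) e' =
            (χ (s e) - χ (t e)) * k := by
          have h0 := hy χ
          have hdec : ∀ ν, χ ν = χ (merge ν) +
              (χ (s e) - χ (t e)) * (Pi.single (s e) 1 : N → ℤ) ν := by
            intro ν
            by_cases h : ν = s e <;> simp [merge, h]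
          calc _ = ∑ e' ∈ S, ((χ (merge (s e')) - χ (merge (t e'))) * y e' +
                (χ (s e) - χ (t e)) * (((Pi.single (s e) 1 : N → ℤ) (s e') -
                  (Pi.single (s e) 1 : N → ℤ) (t e')) * y e')) := by
                refine Finset.sum_congr rfl fun e' h' => ?_
                have : e' ≠ e := fun h => he (h ▸ h')
                rw [Function.update_of_ne this, hdec (s e'), hdec (t e')]
                ring
            _ = _ := by
                rw [Finset.sum_add_distrib, ← Finset.mul_sum]
                simp only [Function.comp] at h0
                rw [h0, zero_add]
        rw [Finset.sum_insert he, hS, Function.update_self]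
        ring
      · have : e' ≠ e := fun h => he (h ▸ he')
        rwa [Function.update_of_ne this]

/-- Let `P` be a permutation of a finite set and `S` a set of points that cut its cycles into
segments. If the differences of `H` along `P` add up to zero over every segment, then `H` takes the
same value at the beginning of all segments of a cycle. -/
theorem Equiv.Perm.apply_eq_of_sameCycle_of_sum_eq_zero {X : Type*} [Fintype X] {P : Equiv.Perm X}
    {S : Set X} {H : X → ℤ}
    (h : ∀ χ : X → ℤ, (∀ x, x ∉ S → χ (P x) = χ x) → ∑ x, χ x * (H x - H (P x)) = 0)
    {x y : X} (hxy : P.SameCycle x y) (hx : x ∈ S) (hy : y ∈ S) : H (P x) = H (P y) := by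
  classical
  -- `χ` is constant on each segment, equal to `H` at the beginning of the next one, so it is an
  -- admissible test function. Testing with it yields `∑ (χ (P x) - χ x) ^ 2 = 0`: passing a stop
  -- does not change `χ`. The default `0` concerns only cycles without stops.
  let χ : X → ℤ := fun x =>
    if hx : ∃ n, P^[n] x ∈ S then H (P (P^[Nat.find hx] x)) else 0
  have hχS : ∀ x ∈ S, χ x = H (P x) := by
    intro x hx
    have hex : ∃ n, P^[n] x ∈ S := ⟨0, hx⟩
    have h0 : Nat.find hex = 0 := (Nat.find_eq_zero _).2 hx
    simp only [χ, dif_pos hex, h0, Function.iterate_zero, id]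
  have hχ : ∀ x, x ∉ S → χ (P x) = χ x := by
    intro x hx
    by_cases hex : ∃ n, P^[n] x ∈ S
    · obtain ⟨n, hn⟩ := hex
      have hex : ∃ n, P^[n] x ∈ S := ⟨n, hn⟩
      have hex' : ∃ n, P^[n] (P x) ∈ S := by
        rcases n with _ | n
        · exact absurd hn hx
        · exact ⟨n, hn⟩
      have h1 : Nat.find hex = Nat.find hex' + 1 := by
        refine (Nat.find_eq_iff _).2 ⟨Nat.find_spec hex', fun n hn => ?_⟩
        rcases n with _ | n
        · exact hx
        · exact Nat.find_min hex' (by omega)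
      simp only [χ, dif_pos hex, dif_pos hex', h1, Function.iterate_succ_apply]
    · have hex' : ¬ ∃ n, P^[n] (P x) ∈ S := fun ⟨n, hn⟩ => hex ⟨n + 1, hn⟩
      simp only [χ, dif_neg hex, dif_neg hex']
  have h1 := h χ hχ
  have h2 : ∑ x, χ (P x) * H (P x) = ∑ x, χ x * H x := Equiv.sum_comp P fun x => χ x * H x
  have h3 : ∑ x, χ (P x) * χ (P x) = ∑ x, χ x * χ x := Equiv.sum_comp P fun x => χ x * χ x
  have h4 : ∑ x, (χ (P x) - χ x) * H (P x) = ∑ x, (χ (P x) - χ x) * χ x := by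
    refine Finset.sum_congr rfl fun x _ => ?_
    by_cases hx : x ∈ S
    · rw [hχS x hx]
    · rw [hχ x hx]
      ring
  have h5 : ∑ x, (χ (P x) - χ x) ^ 2 = 0 := by
    simp only [mul_sub, sub_mul, Finset.sum_sub_distrib] at h1 h4
    have : ∑ x, (χ (P x) - χ x) ^ 2 =
        ∑ x, χ (P x) * χ (P x) + ∑ x, χ x * χ x - 2 * ∑ x, χ (P x) * χ x := by
      rw [Finset.mul_sum, ← Finset.sum_add_distrib, ← Finset.sum_sub_distrib]
      exact Finset.sum_congr rfl fun x _ => by ring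
    rw [this]
    linarith
  have h6 : ∀ x, χ (P x) = χ x := fun x => by
    have := (Finset.sum_eq_zero_iff_of_nonneg fun x _ => sq_nonneg (χ (P x) - χ x)).1 h5 x
      (Finset.mem_univ x)
    exact sub_eq_zero.1 (pow_eq_zero_iff two_ne_zero |>.1 this)
  have h7 : ∀ n x, χ (P^[n] x) = χ x := by
    intro n
    induction n with
    | zero => exact fun x => rfl
    | succ n ih => exact fun x => by rw [Function.iterate_succ_apply, ih, h6]
  obtain ⟨n, rfl⟩ := hxy.exists_nat_pow_eq
  rw [← hχS _ hx, ← hχS _ hy, Equiv.Perm.coe_pow, h7]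

/-! ### The wave equation and diagonal flows -/

namespace SquareGluing

variable {F : Type*} {G : SquareGluing F}

namespace Bicoloring

variable (C : G.Bicoloring)

theorem color_glue {s : F × Fin 4} (hs : G.glue s ≠ s) :
    C.color (G.glue s).1 = !C.color s.1 := by
  have := C.opposite s.1 (G.glue s).1 ⟨s.2, (G.glue s).2, rfl, fun h => hs h.symm⟩
  revert this
  cases C.color s.1 <;> cases C.color (G.glue s).1 <;> simp

end Bicoloring

section Harmonic

variable {A : Type*} [AddCommGroup A]

open Classical in
/-- The value of `g` at the square across the side `s`, zero if the side is free. -/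
noncomputable def across (G : SquareGluing F) (g : F → A) (s : F × Fin 4) : A :=
  if G.glue s = s then 0 else g (G.glue s).1

/-- The discrete wave equation at the black squares, with zero boundary values. -/
def Bicoloring.Harmonic (C : G.Bicoloring) (g : F → A) : Prop :=
  ∀ f, C.color f = true →
    G.across g (f, 0) - G.across g (f, 1) + G.across g (f, 2) - G.across g (f, 3) = 0

/-- The black corners at which a free side ends. -/
def Bicoloring.stops (C : G.Bicoloring) : Set (F × Fin 4) :=
  {κ | C.color κ.1 = true ∧ G.FreeCorner κ}

/-- A function on the corners that describes a flow along the diagonals of the black squares: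
it vanishes on white corners and takes opposite values on opposite corners. -/
structure Bicoloring.IsDiagonal (C : G.Bicoloring) (x : F × Fin 4 → A) : Prop where
  white : ∀ f i, C.color f = false → x (f, i) = 0
  opposite : ∀ f i, x (f, i + 2) = -x (f, i)

/-- The flow is conserved: it adds up to zero over the corners between two consecutive stops. -/
def Bicoloring.IsConserved (C : G.Bicoloring) [Fintype F] (x : F × Fin 4 → A) : Prop :=
  ∀ χ : F × Fin 4 → ℤ, (∀ κ, κ ∉ C.stops → χ (G.rot κ) = χ κ) → ∑ κ, χ κ • x κ = 0

variable {C : G.Bicoloring}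

/-- Opposite corners combine into edges: each black square contributes its two diagonals, from
corner `i` to corner `i + 2` for `i = 0, 1`. Conservation thereby becomes conservation of a graph
flow. -/
theorem Bicoloring.IsDiagonal.sum_smul_eq [Fintype F] {x : F × Fin 4 → A} (hx : C.IsDiagonal x)
    (χ : F × Fin 4 → ℤ) :
    ∑ κ, χ κ • x κ = ∑ e : C.Black × Fin 2,
      (χ (e.1, Fin.castLE (by decide) e.2) - χ (e.1, Fin.castLE (by decide) e.2 + 2)) •
        x (e.1, Fin.castLE (by decide) e.2) := by
  classical
  have hsum : ∀ f, ∑ i, χ (f, i) • x (f, i) = ∑ i : Fin 2,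
      (χ (f, Fin.castLE (by decide) i) - χ (f, Fin.castLE (by decide) i + 2)) •
        x (f, Fin.castLE (by decide) i) := by
    intro f
    have h2 := hx.opposite f 0
    have h3 := hx.opposite f 1
    simp only [Fin.sum_univ_four, Fin.sum_univ_two]
    change χ (f, 0) • x (f, 0) + χ (f, 1) • x (f, 1) + χ (f, 0 + 2) • x (f, 0 + 2) +
      χ (f, 1 + 2) • x (f, 1 + 2) = (χ (f, 0) - χ (f, 0 + 2)) • x (f, 0) +
      (χ (f, 1) - χ (f, 1 + 2)) • x (f, 1)
    rw [h2, h3]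
    simp only [sub_smul, smul_neg]
    abel
  rw [Fintype.sum_prod_type, Fintype.sum_prod_type,
    ← Fintype.sum_subtype_add_sum_subtype (fun f => C.color f = true)]
  rw [Finset.sum_eq_zero (s := (Finset.univ : Finset {f // ¬ C.color f = true})), add_zero]
  · exact Finset.sum_congr rfl fun b _ => hsum b
  · rintro ⟨f, hf⟩ -
    exact Finset.sum_eq_zero fun i _ => by
      rw [hx.white f i (by simpa using hf), smul_zero]

/-- A nonzero conserved diagonal flow yields an integral one. -/
theorem Bicoloring.IsDiagonal.exists_int [Fintype F] {x : F × Fin 4 → A} (hx : C.IsDiagonal x)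
    (hcons : C.IsConserved x) (hne : x ≠ 0) :
    ∃ y : F × Fin 4 → ℤ, C.IsDiagonal y ∧ C.IsConserved y ∧ y ≠ 0 := by
  classical
  -- The nodes of the graph are the classes of corners linked by `rot`, with the link after each
  -- stop cut.
  let r : F × Fin 4 → F × Fin 4 → Prop := fun κ κ' => κ ∉ C.stops ∧ κ' = G.rot κ
  let e₀ : C.Black × Fin 2 → F × Fin 4 := fun e => (e.1, Fin.castLE (by decide) e.2)
  let e₂ : C.Black × Fin 2 → F × Fin 4 := fun e => (e.1, Fin.castLE (by decide) e.2 + 2)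
  have hx0 : ∃ e ∈ (Finset.univ : Finset (C.Black × Fin 2)), x (e₀ e) ≠ 0 := by
    by_contra hzero
    push Not at hzero
    apply hne
    ext ⟨f, i⟩
    by_cases hf : C.color f = true
    · have h0 : x (f, 0) = 0 := hzero (⟨f, hf⟩, 0) (Finset.mem_univ _)
      have h1 : x (f, 1) = 0 := hzero (⟨f, hf⟩, 1) (Finset.mem_univ _)
      have h2 : x (f, 2) = -x (f, 0) := hx.opposite f 0
      have h3 : x (f, 3) = -x (f, 1) := hx.opposite f 1
      fin_cases i
      · exact h0
      · exact h1
      · exact h2.trans (by simp [h0])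
      · exact h3.trans (by simp [h1])
    · exact hx.white f i (by simpa using hf)
  obtain ⟨y, hy, e, -, hye⟩ := exists_int_flow_of_flow Finset.univ
    (fun e => Quot.mk r (e₀ e)) (fun e => Quot.mk r (e₂ e)) (fun e => x (e₀ e))
    (fun χ => by
      have := hcons (fun κ => χ (Quot.mk r κ)) (fun κ hκ =>
        congrArg χ (Quot.sound (r := r) ⟨hκ, rfl⟩).symm)
      rwa [hx.sum_smul_eq] at this) hx0
  let Y : F × Fin 4 → ℤ := fun κ =>
    if h : C.color κ.1 = true then
      ![y (⟨κ.1, h⟩, 0), y (⟨κ.1, h⟩, 1), -y (⟨κ.1, h⟩, 0), -y (⟨κ.1, h⟩, 1)] κ.2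
    else 0
  have hY : C.IsDiagonal Y := by
    refine ⟨fun f i hf => ?_, fun f i => ?_⟩
    · simp [Y, hf]
    · by_cases hf : C.color f = true
      · simp only [Y, hf, dite_true]
        fin_cases i
        · rfl
        · rfl
        · exact (neg_neg _).symm
        · exact (neg_neg _).symm
      · simp [Y, hf]
  have hY₀ : ∀ e, Y (e₀ e) = y e := by
    rintro ⟨⟨f, hf⟩, i⟩
    simp only [Y, e₀, hf, dite_true]
    fin_cases i <;> rfl
  refine ⟨Y, hY, fun χ hχ => ?_, fun h => hye ?_⟩
  · rw [hY.sum_smul_eq]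
    have := hy (Quot.lift χ (by rintro κ _ ⟨hκ, rfl⟩; exact (hχ κ hκ).symm))
    rw [← this]
    exact Finset.sum_congr rfl fun e _ => by
      rw [smul_eq_mul]
      exact congrArg _ (hY₀ e)
  · rw [← hY₀, h]
    rfl

theorem Bicoloring.across_eq_zero {g : F → A} {s : F × Fin 4} (hs : G.glue s = s) :
    G.across g s = 0 := if_pos hs

theorem Bicoloring.across_of_ne {g : F → A} {s : F × Fin 4} (hs : G.glue s ≠ s) :
    G.across g s = g (G.glue s).1 := if_neg hs

/-- The corner function of `g`: its value at the square itself for a white corner, and across the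
side that starts at the corner for a black one. -/
noncomputable def Bicoloring.cornerValue (C : G.Bicoloring) (g : F → A) (κ : F × Fin 4) : A :=
  if C.color κ.1 = true then G.across g κ else g κ.1

theorem Bicoloring.cornerValue_rot_black {g : F → A} {κ : F × Fin 4} (hκ : C.color κ.1 = true) :
    C.cornerValue g (G.rot κ) = G.across g (κ.1, κ.2 - 1) := by
  obtain ⟨f, i⟩ := κ
  by_cases hfree : G.glue (f, i - 1) = (f, i - 1)
  · rw [rot_apply, hfree]
    exact if_pos hκ
  · have hcol := C.color_glue hfree
    simp only at hκ
    rw [hκ] at hcol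
    rw [rot_apply, cornerValue, if_neg (by simp [hcol]), across_of_ne hfree]

/-- Both corners read the value of the same white square, even when `rot` moves along a free side of
it; so only black corners carry flow. -/
theorem Bicoloring.cornerValue_rot_white {g : F → A} {κ : F × Fin 4} (hκ : C.color κ.1 = false) :
    C.cornerValue g (G.rot κ) = C.cornerValue g κ := by
  obtain ⟨f, i⟩ := κ
  simp only at hκ
  by_cases hfree : G.glue (f, i - 1) = (f, i - 1)
  · rw [rot_apply, hfree]
    simp [cornerValue, hκ]
  · have hcol := C.color_glue hfree
    simp only [hκ, Bool.not_false] at hcol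
    have hne : G.glue (G.glue (f, i - 1)) ≠ G.glue (f, i - 1) := by
      rw [G.glue_involutive]
      exact fun h => hfree h.symm
    rw [rot_apply, cornerValue, if_pos hcol, across_of_ne hne, G.glue_involutive]
    simp [cornerValue, hκ]

/-- The differences of the corner function of a harmonic function form a conserved flow. -/
theorem Bicoloring.Harmonic.isDiagonal {g : F → A} (hg : C.Harmonic g) :
    C.IsDiagonal fun κ => C.cornerValue g κ - C.cornerValue g (G.rot κ) := by
  refine ⟨fun f i hf => ?_, fun f i => ?_⟩
  · simp only [cornerValue_rot_white (κ := (f, i)) hf, sub_self]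
  · by_cases hf : C.color f = true
    · have hb : ∀ i, C.cornerValue g (f, i) = G.across g (f, i) := fun i => if_pos hf
      have h := hg f hf
      simp only [cornerValue_rot_black (κ := (f, _)) hf, hb]
      rw [← sub_eq_zero]
      fin_cases i
      · rw [← neg_eq_zero, ← neg_eq_zero, ← h]
        change - -(G.across g (f, 2) - G.across g (f, 1) -
          -(G.across g (f, 0) - G.across g (f, 3))) = _
        abel
      · rw [← neg_eq_zero, ← h]
        change -(G.across g (f, 3) - G.across g (f, 2) -
          -(G.across g (f, 1) - G.across g (f, 0))) = _
        abel
      · rw [← neg_eq_zero, ← neg_eq_zero, ← h]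
        change - -(G.across g (f, 0) - G.across g (f, 3) -
          -(G.across g (f, 2) - G.across g (f, 1))) = _
        abel
      · rw [← neg_eq_zero, ← h]
        change -(G.across g (f, 1) - G.across g (f, 0) -
          -(G.across g (f, 3) - G.across g (f, 2))) = _
        abel
    · have hf' : C.color f = false := by simpa using hf
      simp only [cornerValue_rot_white (κ := (f, _)) hf', sub_self, neg_zero]

/-- The sum telescopes along `rot`. Where `χ` may jump, just after a stop, the corner value is read
across a free side and is zero. -/
theorem Bicoloring.isConserved_cornerValue [Fintype F] (C : G.Bicoloring) (g : F → A) :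
    C.IsConserved fun κ => C.cornerValue g κ - C.cornerValue g (G.rot κ) := by
  intro χ hχ
  simp only [smul_sub, Finset.sum_sub_distrib]
  rw [← Equiv.sum_comp G.rot fun κ => χ κ • C.cornerValue g κ, sub_eq_zero]
  refine Finset.sum_congr rfl fun κ _ => ?_
  by_cases hκ : κ ∈ C.stops
  · rw [cornerValue_rot_black hκ.1, across_eq_zero hκ.2, smul_zero, smul_zero]
  · rw [hχ κ hκ]

end Harmonic

end SquareGluing

/-! ### From an integral flow to an integral solution -/

namespace SquareGluing

variable {F : Type*} {G : SquareGluing F} {C : G.Bicoloring}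

/-- The partial sums of a function on the corners, around each square. -/
def partialSum (x : F × Fin 4 → ℤ) : F × Fin 4 → ℤ
  | (_, 0) => 0
  | (f, 1) => x (f, 1)
  | (f, 2) => x (f, 1) + x (f, 2)
  | (f, 3) => x (f, 1) + x (f, 2) + x (f, 3)

/-- The values at opposite corners cancel, so the partial sums close up after a full turn; this is
the case `i = 0`. -/
theorem Bicoloring.IsDiagonal.partialSum_sub {x : F × Fin 4 → ℤ} (hx : C.IsDiagonal x) (f : F)
    (i : Fin 4) : partialSum x (f, i) - partialSum x (f, i - 1) = x (f, i) := by
  have h2 : x (f, 2) = -x (f, 0) := hx.opposite f 0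
  have h3 : x (f, 3) = -x (f, 1) := hx.opposite f 1
  fin_cases i
  · change 0 - (x (f, 1) + x (f, 2) + x (f, 3)) = x (f, 0)
    rw [h2, h3]
    ring
  · exact sub_zero _
  · exact add_sub_cancel_left _ _
  · exact add_sub_cancel_left _ _

/-- A conserved flow adds up to zero around an interior vertex. -/
theorem Bicoloring.IsConserved.sum_interior [Fintype F] {x : F × Fin 4 → ℤ}
    (hx : C.IsConserved x) {κ : F × Fin 4} (hit : G.rot (G.rot (G.rot (G.rot κ))) = κ) :
    x κ + x (G.rot κ) + x (G.rot (G.rot κ)) + x (G.rot (G.rot (G.rot κ))) = 0 := by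
  classical
  have := hx (fun κ' => (if κ' = κ then 1 else 0) + (if κ' = G.rot κ then 1 else 0) +
      (if κ' = G.rot (G.rot κ) then 1 else 0) +
      (if κ' = G.rot (G.rot (G.rot κ)) then 1 else 0)) (fun κ' _ => by
    have h0 : G.rot κ' = κ ↔ κ' = G.rot (G.rot (G.rot κ)) := by
      rw [← G.rot.injective.eq_iff (b := G.rot _), hit]
    simp only [h0, G.rot.injective.eq_iff]
    ring)
  simpa [add_mul, Finset.sum_add_distrib] using this

/-- A conserved integral flow integrates to a function on the squares. -/
theorem IsQuadriculatedDisk.exists_integral [Fintype F] (hG : G.IsQuadriculatedDisk)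
    {x : F × Fin 4 → ℤ} (hx : C.IsDiagonal x) (hcons : C.IsConserved x) :
    ∃ n : F → ℤ, ∀ s, C.color s.1 = true → G.glue s ≠ s →
      n (G.glue s).1 = n s.1 + partialSum x s := by
  obtain ⟨n, hn⟩ := hG.exists_potential
    (fun s => if C.color s.1 = true then partialSum x s else -partialSum x (G.glue s))
    (fun s hs => by
      have hcol := C.color_glue hs
      by_cases h : C.color s.1 = true
      · simp [h, hcol, G.glue_involutive s]
      · simp [h, hcol])
    (fun κ hκ h4 => by
      have hit : G.rot (G.rot (G.rot (G.rot κ))) = κ := by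
        have := Function.iterate_minimalPeriod (f := G.rot) (x := κ)
        rwa [h4] at this
      have hcol : ∀ n, C.color (G.rot (G.rot^[n] κ)).1 = !C.color (G.rot^[n] κ).1 := fun n =>
        C.color_glue (hκ n)
      have h0 := hcol 0
      have h1 := hcol 1
      have h2 := hcol 2
      simp only [Function.iterate_succ, Function.iterate_zero, Function.comp, id] at h0 h1 h2
      have hps : ∀ κ, partialSum x κ - partialSum x (G.glue (G.rot κ)) = x κ := fun κ => by
        rw [glue_rot]
        exact hx.partialSum_sub κ.1 κ.2
      -- The four increments pair up into the flow at the two black corners of the vertex, so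
      -- conservation there closes the loop.
      have hsum := hcons.sum_interior hit
      cases hc : C.color κ.1
      · rw [hc] at h0
        rw [h0] at h1
        rw [h1] at h2
        have w0 : x κ = 0 := hx.white κ.1 κ.2 hc
        have w2 : x (G.rot (G.rot κ)) = 0 := hx.white _ _ h1
        have p1 := hps (G.rot κ)
        have p3 := hps (G.rot (G.rot (G.rot κ)))
        rw [hit] at p3
        simp only [h0, h1, h2, Bool.not_true, Bool.not_false, if_true, Bool.false_eq_true,
          if_false]
        linarith
      · rw [hc] at h0
        rw [h0] at h1
        rw [h1] at h2
        have w1 : x (G.rot κ) = 0 := hx.white _ _ h0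
        have w3 : x (G.rot (G.rot (G.rot κ))) = 0 := hx.white _ _ h2
        have p0 := hps κ
        have p2 := hps (G.rot (G.rot κ))
        simp only [h0, h1, h2, Bool.not_true, Bool.not_false, if_true, Bool.false_eq_true,
          if_false]
        linarith)
  exact ⟨n, fun s hs hne => by rw [hn s hne, if_pos hs]⟩

/-- A nonzero conserved integral flow comes from a nonzero harmonic function. -/
theorem IsQuadriculatedDisk.exists_harmonic_of_flow [Fintype F] (hG : G.IsQuadriculatedDisk)
    {x : F × Fin 4 → ℤ} (hx : C.IsDiagonal x) (hcons : C.IsConserved x) (hne : x ≠ 0) :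
    ∃ g : F → ℤ, C.Harmonic g ∧ ∃ f, C.color f = false ∧ g f ≠ 0 := by
  obtain ⟨n, hn⟩ := hG.exists_integral hx hcons
  -- The corner function of `n`, except that a free black side receives the value `n + partialSum`
  -- that a neighbor beyond it would have, instead of zero.
  let H : F × Fin 4 → ℤ := fun κ => if C.color κ.1 = true then n κ.1 + partialSum x κ else n κ.1
  have hH : ∀ κ, H κ - H (G.rot κ) = x κ := by
    rintro ⟨f, i⟩
    cases hc : C.color f
    · rw [hx.white f i hc, sub_eq_zero]
      by_cases hfree : G.glue (f, i - 1) = (f, i - 1)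
      · rw [rot_apply, hfree]
        simp [H, hc]
      · have hcol := C.color_glue hfree
        simp only [hc, Bool.not_false] at hcol
        have hne' : G.glue (G.glue (f, i - 1)) ≠ G.glue (f, i - 1) := by
          rw [G.glue_involutive]
          exact fun h => hfree h.symm
        have := hn _ hcol hne'
        rw [G.glue_involutive] at this
        rw [rot_apply]
        simp only [H, hc, hcol, if_true, Bool.false_eq_true, if_false]
        exact this
    · have hps := hx.partialSum_sub f i
      by_cases hfree : G.glue (f, i - 1) = (f, i - 1)
      · rw [rot_apply, hfree]
        simp only [H, hc, if_true]
        linarith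
      · have hcol := C.color_glue hfree
        simp only [hc, Bool.not_true] at hcol
        have := hn (f, i - 1) hc hfree
        rw [rot_apply]
        simp only [H, hc, hcol, if_true, Bool.false_eq_true, if_false]
        linarith
  -- Conservation on the boundary arcs, together with the boundary being one cycle, makes the values
  -- beyond all free black sides equal. Subtracting `k` then gives zero boundary values.
  obtain ⟨k, hk⟩ : ∃ k, ∀ κ ∈ C.stops, H (G.rot κ) = k := by
    by_cases hS : ∃ κ₀, κ₀ ∈ C.stops
    · obtain ⟨κ₀, hκ₀⟩ := hS
      refine ⟨H (G.rot κ₀), fun κ hκ => ?_⟩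
      refine Equiv.Perm.apply_eq_of_sameCycle_of_sum_eq_zero (S := C.stops) (fun χ hχ => ?_)
        (hG.sameCycle_rot hκ.2 hκ₀.2) hκ hκ₀
      simp only [hH]
      exact hcons χ hχ
    · exact ⟨0, fun κ hκ => absurd ⟨κ, hκ⟩ hS⟩
  have hacross : ∀ f i, C.color f = true →
      G.across (fun f => n f - k) (f, i) = n f + partialSum x (f, i) - k := by
    intro f i hf
    by_cases hfree : G.glue (f, i) = (f, i)
    · rw [Bicoloring.across_eq_zero hfree]
      have := hk (f, i + 1) ⟨hf, by simpa [FreeCorner] using hfree⟩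
      rw [rot_succ, hfree] at this
      simp only [H, hf, if_true] at this
      linarith
    · rw [Bicoloring.across_of_ne hfree, hn _ hf hfree]
  refine ⟨fun f => n f - k, fun f hf => ?_, ?_⟩
  · simp only [hacross f _ hf]
    have h1 : partialSum x (f, 1) - partialSum x (f, 0) = x (f, 1) := hx.partialSum_sub f 1
    have h3 : partialSum x (f, 3) - partialSum x (f, 2) = x (f, 3) := hx.partialSum_sub f 3
    have : x (f, 3) = -x (f, 1) := hx.opposite f 1
    linarith
  · by_contra hzero
    push Not at hzero
    apply hne
    ext ⟨f, i⟩
    cases hc : C.color f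
    · exact hx.white f i hc
    · have h0 : ∀ i, n f + partialSum x (f, i) - k = 0 := by
        intro i
        rw [← hacross f i hc]
        by_cases hfree : G.glue (f, i) = (f, i)
        · exact Bicoloring.across_eq_zero hfree
        · rw [Bicoloring.across_of_ne hfree]
          exact hzero _ (by rw [C.color_glue hfree, hc]; rfl)
      have h1 := h0 i
      have h2 := h0 (i - 1)
      rw [← hx.partialSum_sub f i]
      simp only [Pi.zero_apply]
      linarith

/-- If the wave equation has a nonzero solution with values in some abelian group, then it has a
nonzero integral solution. -/
theorem IsQuadriculatedDisk.exists_int_harmonic [Fintype F] {A : Type*} [AddCommGroup A]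
    (hG : G.IsQuadriculatedDisk) {g : F → A} (hg : C.Harmonic g) {f₀ : F}
    (hf₀ : C.color f₀ = false) (hgf₀ : g f₀ ≠ 0) :
    ∃ g : F → ℤ, C.Harmonic g ∧ ∃ f, C.color f = false ∧ g f ≠ 0 := by
  -- If the flow vanishes, `g` continues to a function constant on the disk, with the nonzero value
  -- `g f₀`. Then no black square has a free side, since the value beyond it would be zero, and the
  -- constant `1` is a solution.
  by_cases hx : (fun κ => C.cornerValue g κ - C.cornerValue g (G.rot κ)) = 0
  · have hrot : ∀ κ, C.cornerValue g κ = C.cornerValue g (G.rot κ) := fun κ =>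
      sub_eq_zero.1 (congrFun hx κ)
    have hblack : ∀ f, C.color f = true → ∀ i, G.across g (f, i) = G.across g (f, 0) := by
      intro f hf
      have hstep : ∀ i, G.across g (f, i) = G.across g (f, i - 1) := fun i => by
        rw [← Bicoloring.cornerValue_rot_black (C := C) (κ := (f, i)) hf, ← hrot]
        exact (if_pos hf).symm
      have h1 := hstep 1
      have h2 := hstep 2
      have h3 := hstep 3
      intro i
      fin_cases i
      · rfl
      · exact h1
      · exact h2.trans h1
      · exact h3.trans (h2.trans h1)
    let v : F → A := fun f => if C.color f = true then G.across g (f, 0) else g f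
    have hv : ∀ s, C.color s.1 = true → v (G.glue s).1 = v s.1 := by
      intro s hs
      by_cases hfree : G.glue s = s
      · rw [hfree]
      · have hcol := C.color_glue hfree
        rw [hs] at hcol
        simp only [v, hs, hcol, Bool.not_true, if_true, Bool.false_eq_true, if_false]
        rw [← hblack _ hs s.2]
        exact (Bicoloring.across_of_ne hfree).symm
    have hv' : ∀ s, v (G.glue s).1 = v s.1 := by
      intro s
      by_cases hs : C.color s.1 = true
      · exact hv s hs
      · by_cases hfree : G.glue s = s
        · rw [hfree]
        · have hcol : C.color (G.glue s).1 = true := by rw [C.color_glue hfree]; simpa using hs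
          have := hv (G.glue s) hcol
          rw [G.glue_involutive] at this
          exact this.symm
    have hconst := hG.eq_of_glue v hv'
    refine ⟨fun _ => 1, fun f hf => ?_, f₀, hf₀, one_ne_zero⟩
    have hne : ∀ i, G.glue (f, i) ≠ (f, i) := by
      intro i hfree
      apply hgf₀
      have h1 : v f₀ = g f₀ := by simp [v, hf₀]
      have h2 : v f = 0 := by
        simp only [v, hf, if_true]
        rw [← hblack f hf i, Bicoloring.across_eq_zero hfree]
      rw [← h1, hconst f₀ f, h2]
    simp [Bicoloring.across_of_ne (hne _)]
  · obtain ⟨y, hy, hycons, hyne⟩ := hg.isDiagonal.exists_int (C.isConserved_cornerValue g) hx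
    exact hG.exists_harmonic_of_flow hy hycons hyne

end SquareGluing

/-! ### The kernel of the black-to-white matrix and the determinant -/

namespace SquareGluing

variable {F : Type*} {G : SquareGluing F} {C : G.Bicoloring}

/-- A row of the black-to-white matrix adds up the values at the neighbors. -/
theorem IsQuadriculatedDisk.blackToWhite_mulVec [Fintype F] (hG : G.IsQuadriculatedDisk)
    {R : Type*} [CommRing R] {b w : ℕ} (eb : C.Black ≃ Fin b) (ew : C.White ≃ Fin w)
    (u : F → R) (i : Fin b) :
    ((C.blackToWhite eb ew).map (Int.cast : ℤ → R)).mulVec (fun j => u (ew.symm j)) i =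
      ∑ k : Fin 4, G.across u (eb.symm i, k) := by
  classical
  set f : F := (eb.symm i).1
  have hcol : C.color f = true := (eb.symm i).2
  -- A side shared twice would count once in the matrix and twice on the right; `side_unique`
  -- excludes this.
  have hentry : ∀ j, ((C.blackToWhite eb ew).map (Int.cast : ℤ → R)) i j * u (ew.symm j) =
      ∑ k : Fin 4, if G.glue (f, k) ≠ (f, k) ∧ (G.glue (f, k)).1 = ew.symm j then
        u (ew.symm j) else 0 := by
    intro j
    simp only [Matrix.map_apply, Bicoloring.blackToWhite, Matrix.of_apply]
    by_cases hs : G.ShareSide f (ew.symm j)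
    · rw [if_pos hs]
      obtain ⟨k, l, hkl, hne⟩ := hs
      have hk : G.glue (f, k) ≠ (f, k) ∧ (G.glue (f, k)).1 = ew.symm j :=
        ⟨by rw [hkl]; exact hne.symm, by rw [hkl]⟩
      rw [Finset.sum_eq_single k, if_pos hk]
      · simp
      · intro k' _ hk'
        rw [if_neg]
        rintro ⟨h1, h2⟩
        exact hk' (hG.side_unique h1 hk.1 (h2.trans hk.2.symm))
      · simp
    · rw [if_neg hs, Finset.sum_eq_zero]
      · simp
      · intro k _
        rw [if_neg]
        rintro ⟨h1, h2⟩
        have h3 : G.glue (f, k) = ((ew.symm j : C.White).1, (G.glue (f, k)).2) := Prod.ext h2 rfl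
        exact hs ⟨k, (G.glue (f, k)).2, h3, fun h => h1 (h3.trans h.symm)⟩
  simp only [Matrix.mulVec, dotProduct, hentry]
  rw [Finset.sum_comm]
  refine Finset.sum_congr rfl fun k _ => ?_
  by_cases hfree : G.glue (f, k) = (f, k)
  · simp [hfree, Bicoloring.across_eq_zero hfree]
  · have hw : C.color (G.glue (f, k)).1 = false := by rw [C.color_glue hfree, hcol]; rfl
    rw [Bicoloring.across_of_ne hfree, Finset.sum_eq_single (ew ⟨_, hw⟩)]
    · simp [hfree]
    · intro j _ hj
      rw [if_neg]
      rintro ⟨-, h⟩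
      apply hj
      rw [← Equiv.symm_apply_eq]
      exact Subtype.ext h.symm
    · simp

/-- After a change of signs, the kernel of the black-to-white matrix consists of the solutions of
the wave equation. -/
theorem Bicoloring.harmonic_sign_mul_iff {R : Type*} [CommRing R] {σ τ : F → ℤˣ}
    (hσ : ∀ s, G.glue s ≠ s → σ (G.glue s).1 = τ s.1 * (-1) ^ (s.2 : ℕ)) (u : F → R) :
    C.Harmonic (fun f => ((σ f : ℤ) : R) * u f) ↔
      ∀ f, C.color f = true → ∑ k : Fin 4, G.across u (f, k) = 0 := by
  have hacross : ∀ s, G.across (fun f => ((σ f : ℤ) : R) * u f) s =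
      ((τ s.1 : ℤ) : R) * (-1) ^ (s.2 : ℕ) * G.across u s := by
    intro s
    by_cases hfree : G.glue s = s
    · rw [across_eq_zero hfree, across_eq_zero hfree, mul_zero]
    · rw [across_of_ne hfree, across_of_ne hfree, hσ s hfree]
      push_cast
      ring
  refine forall₂_congr fun f _ => ?_
  have hunit : IsUnit ((τ f : ℤ) : R) := (Units.map (Int.castRingHom R).toMonoidHom (τ f)).isUnit
  rw [← hunit.mul_right_eq_zero (b := ∑ k : Fin 4, _), Fin.sum_univ_four]
  simp only [hacross]
  refine Eq.congr_left ?_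
  change ((τ f : ℤ) : R) * (-1) ^ 0 * _ - ((τ f : ℤ) : R) * (-1) ^ 1 * _ +
    ((τ f : ℤ) : R) * (-1) ^ 2 * _ - ((τ f : ℤ) : R) * (-1) ^ 3 * _ = _
  ring

theorem IsQuadriculatedDisk.det_blackToWhite [Fintype F] (hG : G.IsQuadriculatedDisk) {n : ℕ}
    (eb : C.Black ≃ Fin n) (ew : C.White ≃ Fin n) :
    (C.blackToWhite eb ew).det = 0 ∨ (C.blackToWhite eb ew).det = 1 ∨
      (C.blackToWhite eb ew).det = -1 := by
  classical
  obtain ⟨σ, τ, hσ⟩ := hG.exists_sign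
  by_contra hdet
  push Not at hdet
  obtain ⟨h0, h1, h2⟩ := hdet
  -- A kernel vector modulo `p` will yield an integral one, which contradicts `h0`.
  obtain ⟨p, hp, hpd⟩ := Nat.exists_prime_and_dvd (n := (C.blackToWhite eb ew).det.natAbs) (by
    intro h
    rcases Int.natAbs_eq_iff.1 h with h | h
    · exact h1 h
    · exact h2 h)
  have : Fact p.Prime := ⟨hp⟩
  have hdet0 : ((C.blackToWhite eb ew).map (Int.cast : ℤ → ZMod p)).det = 0 := by
    have : ((C.blackToWhite eb ew).map (Int.castRingHom (ZMod p))).det = 0 := by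
      rw [← RingHom.mapMatrix_apply, ← RingHom.map_det]
      exact (ZMod.intCast_zmod_eq_zero_iff_dvd _ p).2 (Int.natCast_dvd.2 hpd)
    exact this
  obtain ⟨v, hv, hv0⟩ := Matrix.exists_mulVec_eq_zero_iff.2 hdet0
  obtain ⟨j, hj⟩ := Function.ne_iff.1 hv
  let u : F → ZMod p := fun f => if h : C.color f = false then v (ew ⟨f, h⟩) else 0
  have hu : ∀ j, u (ew.symm j) = v j := by
    intro j
    have : C.color (ew.symm j) = false := (ew.symm j).2
    simp [u, this]
  have hharm : C.Harmonic (fun f => ((σ f : ℤ) : ZMod p) * u f) := by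
    rw [Bicoloring.harmonic_sign_mul_iff hσ]
    intro f hf
    have := hG.blackToWhite_mulVec eb ew u (eb ⟨f, hf⟩)
    simp only [hu, hv0, Equiv.symm_apply_apply] at this
    exact this.symm
  obtain ⟨g, hg, f, hf, hgf⟩ := hG.exists_int_harmonic hharm (f₀ := ew.symm j) (ew.symm j).2 (by
    rw [hu]
    rcases Int.units_eq_one_or (σ (ew.symm j)) with h | h <;> simpa [h] using hj)
  have hsq : ∀ f, ((σ f : ℤ)) * ((σ f : ℤ) * g f) = g f := by
    intro f
    rw [← mul_assoc, ← Units.val_mul, Int.units_mul_self]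
    simp
  have hker := (Bicoloring.harmonic_sign_mul_iff (C := C) hσ
    (fun f => (σ f : ℤ) * g f)).1 (by simpa only [Int.cast_id, hsq] using hg)
  refine h0 (Matrix.exists_mulVec_eq_zero_iff.1
    ⟨fun j => (σ (ew.symm j) : ℤ) * g (ew.symm j), fun hzero => hgf ?_, ?_⟩)
  · have := congrFun hzero (ew ⟨f, hf⟩)
    simpa using this
  · ext i
    have := hG.blackToWhite_mulVec eb ew (fun f => (σ f : ℤ) * g f) i
    rw [hker _ (eb.symm i).2] at this
    have hid : (C.blackToWhite eb ew).map (Int.cast : ℤ → ℤ) = C.blackToWhite eb ew := by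
      ext; simp
    rw [hid] at this
    exact this

/-! ### The signed count of the tilings -/

/-- The permutation of the labels that belongs to a pairing of black and white squares. -/
def Bicoloring.labelPerm {n : ℕ} (eb : C.Black ≃ Fin n) (ew : C.White ≃ Fin n)
    (T : C.Black ≃ C.White) : Equiv.Perm (Fin n) :=
  (ew.symm.trans T.symm).trans eb

/-- Transported to the labels, the permutation comparing `T` with `T₀` is the quotient of their
label permutations, and sign is invariant under conjugation and inversion. -/
theorem Bicoloring.tilingSign_eq [Fintype F] {n : ℕ} (eb : C.Black ≃ Fin n) (ew : C.White ≃ Fin n)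
    (T₀ T : C.DominoTiling) :
    C.tilingSign T₀ T = Equiv.Perm.sign (labelPerm eb ew T₀.1) *
      Equiv.Perm.sign (labelPerm eb ew T.1) := by
  classical
  have h : labelPerm eb ew T₀.1 * (labelPerm eb ew T.1)⁻¹ =
      (eb.symm.trans (T.1.trans T₀.1.symm)).trans eb := by
    ext x
    simp [labelPerm, Equiv.Perm.mul_apply, Equiv.Perm.inv_def]
  have h2 := Equiv.Perm.sign_symm_trans_trans (T.1.trans T₀.1.symm) eb
  rw [← h, Equiv.Perm.sign_mul, Equiv.Perm.sign_inv] at h2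
  rw [h2]
  unfold tilingSign
  congr!

/-- In the Leibniz expansion a term is nonzero only if every label is matched to that of a neighbor,
that is, if the permutation comes from a tiling. -/
theorem Bicoloring.det_blackToWhite_eq_sum [Fintype F] {n : ℕ} (eb : C.Black ≃ Fin n)
    (ew : C.White ≃ Fin n) :
    (C.blackToWhite eb ew).det =
      ∑ T : C.DominoTiling, (Equiv.Perm.sign (labelPerm eb ew T.1) : ℤ) := by
  classical
  rw [Matrix.det_apply']
  symm
  refine Finset.sum_of_injOn (fun T : C.DominoTiling => labelPerm eb ew T.1) ?_ ?_ ?_ ?_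
  · intro T _ T' _ h
    apply Subtype.ext
    have h1 : T.1.symm = T'.1.symm := by
      ext1 x
      have := congrArg (fun P : Equiv.Perm (Fin n) => eb.symm (P (ew x))) h
      simpa [labelPerm] using this
    rw [← T.1.symm_symm, h1, Equiv.symm_symm]
  · intro T _
    simp
  · intro P _ hP
    by_contra hne
    have hprod := right_ne_zero_of_mul hne
    have hshare : ∀ j, G.ShareSide (eb.symm (P j)) (ew.symm j) := by
      intro j
      by_contra hj
      refine (Finset.prod_ne_zero_iff.1 hprod j (Finset.mem_univ j)) ?_
      simp [blackToWhite, hj]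
    refine hP ⟨⟨(eb.trans P.symm).trans ew.symm, fun x => ?_⟩,
      Finset.mem_coe.2 (Finset.mem_univ _), ?_⟩
    · have := hshare (P.symm (eb x))
      simpa using this
    · ext x
      simp [labelPerm]
  · intro T _
    rw [Finset.prod_eq_one, mul_one]
    · simp
    · intro j _
      have := T.2 (T.1.symm (ew.symm j))
      rw [Equiv.apply_symm_apply] at this
      simp [blackToWhite, labelPerm, this]

theorem Bicoloring.signedTilingCount_eq [Fintype F] {n : ℕ} (eb : C.Black ≃ Fin n)
    (ew : C.White ≃ Fin n) (T₀ : C.DominoTiling) :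
    C.signedTilingCount T₀ = (C.blackToWhite eb ew).det ∨
      C.signedTilingCount T₀ = -(C.blackToWhite eb ew).det := by
  have h : C.signedTilingCount T₀ =
      (Equiv.Perm.sign (labelPerm eb ew T₀.1) : ℤ) * (C.blackToWhite eb ew).det := by
    rw [det_blackToWhite_eq_sum, Finset.mul_sum]
    exact Finset.sum_congr rfl fun T _ => by rw [tilingSign_eq eb ew, Units.val_mul]
  rw [h]
  rcases Int.units_eq_one_or (Equiv.Perm.sign (labelPerm eb ew T₀.1)) with h | h
  · left; simp [h]
  · right; simp [h]

end SquareGluing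

theorem corollary2 {F : Type*} [Fintype F] (G : SquareGluing F) (hG : G.IsQuadriculatedDisk)
    (C : G.Bicoloring) (n : ℕ) (eb : C.Black ≃ Fin n) (ew : C.White ≃ Fin n) :
    ((C.blackToWhite eb ew).det = 0 ∨ (C.blackToWhite eb ew).det = 1 ∨
      (C.blackToWhite eb ew).det = -1) ∧
    ∀ T₀ : C.DominoTiling,
      (C.signedTilingCount T₀ = (C.blackToWhite eb ew).det ∨
        C.signedTilingCount T₀ = -(C.blackToWhite eb ew).det) ∧
      (C.signedTilingCount T₀ = 0 ∨ C.signedTilingCount T₀ = 1 ∨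
        C.signedTilingCount T₀ = -1) := by
  have hdet := hG.det_blackToWhite eb ew
  refine ⟨hdet, fun T₀ => ?_⟩
  have hcount := C.signedTilingCount_eq eb ew T₀
  refine ⟨hcount, ?_⟩
  omega
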